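/- A (possibly killed) subordinator is a process $H=(H_t)_{t\ge 0}$ with values in $[0,\infty]$, $H_0=0$, with non-decreasing right-continuous paths, absorbed at the cemetery state $\infty$, such that for all $s,t\ge 0$, on the event $\{H_t<\infty\}$ the increment $H_{t+s}-H_t$ is independent of $\sigma(H_u:u\le t)$ and has the law of $H_s$. Its potential measure is $U(B)=\int_0^\infty \mathbb P(H_t\in B)\,dt$ for Borel $B\subseteq[0,\infty)$. A Lévy measure of $H$ is a measure $\nu$ on $(0,\infty)$ with $\int (1\wedge x)\,\nu(dx)<\infty$ such that, for some $\kappa,\mathrm d\ge 0$, $$\mathbb E\big[e^{-\theta H_t};\,H_t<\infty\big]=\exp\Big(-t\Big(\kappa+\mathrm d\,\theta+\int_{(0,\infty)}(1-e^{-\theta x})\,\nu(dx)\Big)\Big),\qquad t,\theta\ge 0.$$ A function $f\ge 0$ on $(0,\infty)$ is log convex if $f(ax+by)\le f(x)^a f(y)^b$ for all $x,y>0$ and $a,b>0$ with $a+b=1$ (that is, $\log f$ is convex, where $\log 0=-\infty$). **Corollary 2.3.** Let $H$ be a (possibly killed) subordinator such that the restriction of its potential measure to $(0,\infty)$ has a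 density $W'\ge 0$ with respect to Lebesgue measure, where $W'$ is non-increasing and differentiable on $(0,\infty)$, and $-W''$ is non-increasing and log convex on $(0,\infty)$. Then $H$ has a Lévy measure, and every Lévy measure of $H$ has a density with respect to Lebesgue measure on $(0,\infty)$ which is non-negative and non-increasing. -/

import Mathlib

open MeasureTheory Set
open scoped NNReal ENNReal

namespace Subord

/-- A (possibly killed) subordinator `H = (H_t)_{t ≥ 0}` on a probability space `(Ω, P)`.
The state space is `[0, ∞]`, where `∞` is the cemetery: the lifetime is
`ζ = inf {t | H_t = ∞}`. The process starts from `0`, has non-decreasing right-continuous paths,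
and its increments are independent and homogeneous on `[0, ζ)`: on the event `{H_t < ∞}`, the
increment `H_{t+s} - H_t` is independent of `σ(H_u : u ≤ t)` and has the law of `H_s`
(by the convention of `ℝ≥0∞`, `∞ - x = ∞` for finite `x`). A subordinator in the
strict sense is the case where `H_t < ∞` almost surely for all `t`. -/
structure IsSubordinator {Ω : Type*} [MeasurableSpace Ω] (P : Measure Ω)
    (H : ℝ≥0 → Ω → ℝ≥0∞) : Prop where
  measurable : ∀ t, Measurable (H t)
  zero : ∀ ω, H 0 ω = 0
  mono : ∀ ω, Monotone fun t => H t ω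
  right_cont : ∀ ω t, ContinuousWithinAt (fun u => H u ω) (Ici t) t
  increments : ∀ s t : ℝ≥0, ∀ A : Set Ω,
    MeasurableSet[⨆ u : Iic t, MeasurableSpace.comap (H u) inferInstance] A →
    ∀ B : Set ℝ≥0∞, MeasurableSet B →
      P (A ∩ {ω | H t ω < ∞} ∩ {ω | H (t + s) ω - H t ω ∈ B}) =
        P (A ∩ {ω | H t ω < ∞}) * P {ω | H s ω ∈ B}

/-- The potential measure `U(B) = ∫_0^∞ P(H_t ∈ B) dt`, `B ⊆ [0, ∞)` Borel, seen as a measure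
on `ℝ` (see `potentialMeasure_apply` for the formula). -/
noncomputable def potentialMeasure {Ω : Type*} [MeasurableSpace Ω] (P : Measure Ω)
    (H : ℝ≥0 → Ω → ℝ≥0∞) : Measure ℝ :=
  (((volume.restrict (Ici (0 : ℝ))).bind fun t => P.map (H t.toNNReal)).restrict {∞}ᶜ).map
    ENNReal.toReal

theorem potentialMeasure_apply {Ω : Type*} [MeasurableSpace Ω] {P : Measure Ω}
    [IsProbabilityMeasure P] {H : ℝ≥0 → Ω → ℝ≥0∞} (hH : IsSubordinator P H)
    {B : Set ℝ} (hB : MeasurableSet B) :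
    potentialMeasure P H B =
      ∫⁻ t in Ici (0 : ℝ), P {ω | H t.toNNReal ω < ∞ ∧ (H t.toNNReal ω).toReal ∈ B} := by
  have hprob : ∀ t, IsProbabilityMeasure (P.map (H t)) := fun t =>
    Measure.isProbabilityMeasure_map (hH.measurable t).aemeasurable
  have hmeas : Measurable fun t => P.map (H t) := by
    refine Measurable.measure_of_isPiSystem_of_isProbabilityMeasure
      (S := range Iic) (BorelSpace.measurable_eq.trans (borel_eq_generateFrom_Iic ℝ≥0∞))
      isPiSystem_Iic ?_
    rintro _ ⟨a, rfl⟩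
    have : Antitone fun t => P.map (H t) (Iic a) := by
      intro s t hst
      simp only [Measure.map_apply (hH.measurable _) measurableSet_Iic]
      exact measure_mono fun ω hω => (hH.mono ω hst).trans hω
    exact this.measurable
  have hB' : MeasurableSet (ENNReal.toReal ⁻¹' B) := ENNReal.measurable_toReal hB
  have hC : MeasurableSet (ENNReal.toReal ⁻¹' B ∩ {∞}ᶜ) :=
    hB'.inter (measurableSet_singleton _).compl
  have hmeas' : Measurable fun t : ℝ => P.map (H t.toNNReal) :=
    hmeas.comp measurable_real_toNNReal
  rw [potentialMeasure, Measure.map_apply ENNReal.measurable_toReal hB,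
    Measure.restrict_apply hB', Measure.bind_apply hC hmeas'.aemeasurable]
  refine lintegral_congr fun t => ?_
  rw [Measure.map_apply (hH.measurable _) hC]
  congr 1
  ext ω
  simp [lt_top_iff_ne_top, and_comm]

/-- `ν` is the Lévy measure of `H`: it is a measure concentrated on `(0, ∞)` with
`∫ (1 ∧ x) ν(dx) < ∞`, and for some killing rate `κ ≥ 0` and drift `d ≥ 0`,
`E[exp(-θ H_t); H_t < ∞] = exp(-t h(θ))` for all `t, θ ≥ 0`, with Laplace exponent
`h(θ) = κ + d θ + ∫_{(0,∞)} (1 - exp(-θ x)) ν(dx)`. -/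
def IsLevyMeasure {Ω : Type*} [MeasurableSpace Ω] (P : Measure Ω)
    (H : ℝ≥0 → Ω → ℝ≥0∞) (ν : Measure ℝ) : Prop :=
  ν (Iic 0) = 0 ∧ ∫⁻ x, ENNReal.ofReal (min 1 x) ∂ν < ∞ ∧
    ∃ κ d : ℝ, 0 ≤ κ ∧ 0 ≤ d ∧ ∀ (t : ℝ≥0) (θ : ℝ), 0 ≤ θ →
      ∫ ω in {ω | H t ω < ∞}, Real.exp (-θ * (H t ω).toReal) ∂P =
        Real.exp (-(t : ℝ) * (κ + d * θ + ∫ x, (1 - Real.exp (-θ * x)) ∂ν))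

/-- The restriction of `μ` to `(0, ∞)` has density `g ≥ 0` with respect to Lebesgue measure. -/
def HasDensityOnIoi (μ : Measure ℝ) (g : ℝ → ℝ) : Prop :=
  (∀ x ∈ Ioi (0 : ℝ), 0 ≤ g x) ∧
    μ.restrict (Ioi 0) = (volume.restrict (Ioi 0)).withDensity fun x => ENNReal.ofReal (g x)

/-- `f ≥ 0` is log convex on `s`: `log f` is convex, with the convention `log 0 = -∞`. -/
def LogConvexOn (s : Set ℝ) (f : ℝ → ℝ) : Prop :=
  Convex ℝ s ∧ (∀ x ∈ s, 0 ≤ f x) ∧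
    ∀ x ∈ s, ∀ y ∈ s, ∀ a b : ℝ, 0 < a → 0 < b → a + b = 1 →
      f (a * x + b * y) ≤ f x ^ a * f y ^ b

end Subord

/-!
Let `Φ` be the Laplace exponent of `H`. Multiplicativity of `t ↦ E[e^{-θ H_t}; H_t < ∞]` gives its
existence, and integrating over `t` shows that the Laplace transform of the potential measure is
`1 / Φ`; hence `1 / Φ(θ) = a + ∫_0^∞ e^{-θx} w(x) dx`, where `a` is the mass of the atom at `0`.
The point is that the reciprocal of such a transform is a Laplace exponent with a non-increasing
Lévy density. Equivalently, `Φ(θ) / θ` is the Laplace transform of a measure with an atom at `0` and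
a non-increasing convex density `C` on `(0, ∞)`: then `C` is a constant plus the tail of a measure
with the non-increasing density `-C'`, and integration by parts gives the Lévy–Khintchine formula
(`exists_tail_density`, `mul_laplace_eq`). In particular the general Lévy–Khintchine theorem is not
needed.

Convexity of `C` is a refinement of Kaluza's theorem, proved on a lattice. Let `u_n > 0` have
non-negative, non-increasing, log convex differences `v_n = u_n - u_{n+1}`, and write
`1 / ∑ u_n z^n = f_0 - ∑_{n ≥ 1} f_n z^n`. Then `u` is log convex, so `f_n ≥ 0` for `n ≥ 1` by
Kaluza's argument, and moreover `f_n` is non-increasing in `n ≥ 1`. Indeed, with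
`ρ = v_n / v_{n-1}`, for `n ≥ 2`,
`u_0 (f_n - f_{n+1}) = f_n (u_0 - v_0 - ρ u_0) + ∑_{k=1}^{n-1} f_k (ρ v_{n-1-k} - v_{n-k})`,
where the terms of the sum are non-negative; replacing `f_k` by the smaller `f_n`, the right side
telescopes to `f_n (u_n - ρ u_{n-1})`, which is non-negative because `u_n / u_{n-1}` dominates the
ratio of the differences (`LogConvexDiff.recip_mono`). The partial sums
`c_n = f_0 - f_1 - ... - f_n` are therefore non-negative, non-increasing and convex, and they are
the coefficients of `1 / ((1 - z) ∑ u_n z^n)`.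

The sequences `u_n = w((n + 1)ε)`, with `a / ε` added to `u_0`, satisfy these hypotheses. As `ε → 0`
the Riemann sums `ε ∑ u_n e^{-θnε}` converge to `1 / Φ(θ)`, and a selection principle for convex
sequences (`exists_subseq_tendsto_convex`) provides `C` as a limit of the rescaled step functions
`c_n`; mass may escape to `0` only, where it produces the drift (`exists_laplace_limit`). Finally,
the Laplace exponent determines the Lévy measure (`levyMeasure_ext`), so that every Lévy measure is
the one that has been constructed.
-/

open Filter Topology

/-! ### Reciprocals of power series with log convex differences -/

section Kaluza

/-- The `n`-th coefficient of `1 / ∑ u_n z^n`. -/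
noncomputable def recipCoeff (u : ℕ → ℝ) (n : ℕ) : ℝ := PowerSeries.coeff n (PowerSeries.mk u)⁻¹

/-- The `n`-th coefficient of `1 / ((1 - z) ∑ u_n z^n)`. -/
noncomputable def conjCoeff (u : ℕ → ℝ) (n : ℕ) : ℝ := ∑ k ∈ Finset.range (n + 1), recipCoeff u k

variable {u : ℕ → ℝ}

lemma sum_recipCoeff_mul (h0 : u 0 ≠ 0) (n : ℕ) :
    ∑ k ∈ Finset.range (n + 1), recipCoeff u k * u (n - k) = if n = 0 then 1 else 0 := by
  have h : (PowerSeries.mk u)⁻¹ * PowerSeries.mk u = 1 :=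
    PowerSeries.inv_mul_cancel _ (by simpa using h0)
  have := congrArg (PowerSeries.coeff n) h
  rw [PowerSeries.coeff_mul, PowerSeries.coeff_one,
    Finset.Nat.sum_antidiagonal_eq_sum_range_succ_mk] at this
  simpa [recipCoeff] using this

lemma recipCoeff_zero (h0 : u 0 ≠ 0) : recipCoeff u 0 * u 0 = 1 := by
  simpa using sum_recipCoeff_mul h0 0

/-- The convolution of `u` and `conjCoeff u` is constantly `1`. -/
lemma sum_conjCoeff_mul (h0 : u 0 ≠ 0) (n : ℕ) :
    ∑ k ∈ Finset.range (n + 1), conjCoeff u k * u (n - k) = 1 := by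
  have h : (PowerSeries.mk u)⁻¹ * PowerSeries.mk u = 1 :=
    PowerSeries.inv_mul_cancel _ (by simpa using h0)
  have hc : PowerSeries.mk (conjCoeff u) = (PowerSeries.mk u)⁻¹ * PowerSeries.mk 1 := by
    ext n
    rw [PowerSeries.coeff_mul, PowerSeries.coeff_mk,
      Finset.Nat.sum_antidiagonal_eq_sum_range_succ_mk]
    simp [conjCoeff, recipCoeff]
  have h2 : PowerSeries.mk (conjCoeff u) * PowerSeries.mk u = PowerSeries.mk 1 := by
    rw [hc, mul_right_comm, h, one_mul]
  have := congrArg (PowerSeries.coeff n) h2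
  rw [PowerSeries.coeff_mul, Finset.Nat.sum_antidiagonal_eq_sum_range_succ_mk] at this
  simpa using this

/-- The recursion for the coefficients `f_{n+1} = -recipCoeff u (n+1)`. -/
lemma recipCoeff_succ (h0 : u 0 ≠ 0) (n : ℕ) :
    -recipCoeff u (n + 1) * u 0 =
      recipCoeff u 0 * u (n + 1) - ∑ k ∈ Finset.range n, -recipCoeff u (k + 1) * u (n - k) := by
  have := sum_recipCoeff_mul h0 (n + 1)
  rw [Finset.sum_range_succ, Finset.sum_range_succ'] at this
  simp only [Nat.add_sub_add_right, Nat.sub_zero, Nat.sub_self, Nat.succ_ne_zero, if_false,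
    neg_mul, Finset.sum_neg_distrib] at this ⊢
  linarith

/-- **Kaluza's theorem**: if the ratios of `u` are non-decreasing, the coefficients of the
reciprocal series are non-positive from index `1` on. -/
lemma recipCoeff_succ_nonpos (hu : ∀ n, 0 < u n) (hr : Monotone fun n => u (n + 1) / u n)
    (n : ℕ) : 0 ≤ -recipCoeff u (n + 1) := by
  have h0 : u 0 ≠ 0 := (hu 0).ne'
  induction n using Nat.strong_induction_on with
  | _ n ih =>
    have key : 0 ≤ -recipCoeff u (n + 1) * u 0 := by
      rw [recipCoeff_succ h0]
      have he : recipCoeff u 0 * u n ≥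
          ∑ k ∈ Finset.range n, -recipCoeff u (k + 1) * u (n - 1 - k) := by
        rcases n with _ | n
        · simp only [Finset.range_zero, Finset.sum_empty]
          rw [recipCoeff_zero h0]; norm_num
        · have := recipCoeff_succ h0 n
          rw [Finset.sum_range_succ]
          simp only [Nat.add_sub_cancel, Nat.sub_self]
          linarith
      have h1 : u (n + 1) = (u (n + 1) / u n) * u n := by
        field_simp [(hu n).ne']
      have h2 : ∑ k ∈ Finset.range n, -recipCoeff u (k + 1) * u (n - k) ≤
          (u (n + 1) / u n) * ∑ k ∈ Finset.range n, -recipCoeff u (k + 1) * u (n - 1 - k) := by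
        rw [Finset.mul_sum]
        refine Finset.sum_le_sum fun k hk => ?_
        have hk := Finset.mem_range.1 hk
        have hm := hr (show n - 1 - k ≤ n by omega)
        simp only at hm
        rw [show n - 1 - k + 1 = n - k by omega, div_le_iff₀ (hu _)] at hm
        calc _ ≤ -recipCoeff u (k + 1) * (u (n + 1) / u n * u (n - 1 - k)) :=
              mul_le_mul_of_nonneg_left hm (ih k hk)
          _ = _ := by ring
      have h3 : 0 ≤ u (n + 1) / u n := (div_pos (hu _) (hu _)).le
      have h4 := mul_le_mul_of_nonneg_left he h3
      have h5 : recipCoeff u 0 * u (n + 1) = (u (n + 1) / u n) * (recipCoeff u 0 * u n) := by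
        have := (hu n).ne'
        field_simp
      linarith
    exact nonneg_of_mul_nonneg_left key (hu 0)

/-- The ratio `v_{n+1} / v_n` of successive differences `v_n = u_n - u_{n+1}`. The junk value `0` for
`v_n = 0` is the right one, since `v` vanishes from `n` on if it is non-negative and
non-increasing. -/
noncomputable def diffRatio (u : ℕ → ℝ) (n : ℕ) : ℝ := (u (n + 1) - u (n + 2)) / (u n - u (n + 1))

/-- A positive sequence `u` whose differences `v_n = u_n - u_{n+1}` are non-negative, non-increasing
and log convex. -/
structure LogConvexDiff (u : ℕ → ℝ) : Prop where
  pos : ∀ n, 0 < u n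
  anti : ∀ n, u (n + 1) ≤ u n
  diff_anti : ∀ n, u (n + 1) - u (n + 2) ≤ u n - u (n + 1)
  diff_log : ∀ n, (u (n + 1) - u (n + 2)) ^ 2 ≤ (u n - u (n + 1)) * (u (n + 2) - u (n + 3))

namespace LogConvexDiff

variable (h : LogConvexDiff u)
include h

lemma diff_succ (n : ℕ) : u (n + 1) - u (n + 2) = diffRatio u n * (u n - u (n + 1)) := by
  rcases (sub_nonneg.2 (h.anti n)).eq_or_lt' with h0 | h0
  · have := h.diff_anti n
    have := h.anti (n + 1)
    rw [h0, mul_zero]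
    have : u (n + 1 + 1) = u (n + 2) := rfl
    linarith
  · rw [diffRatio, div_mul_cancel₀ _ h0.ne']

lemma diffRatio_nonneg (n : ℕ) : 0 ≤ diffRatio u n :=
  div_nonneg (sub_nonneg.2 (h.anti (n + 1))) (sub_nonneg.2 (h.anti n))

lemma diffRatio_le_one (n : ℕ) : diffRatio u n ≤ 1 :=
  div_le_one_of_le₀ (h.diff_anti n) (sub_nonneg.2 (h.anti n))

lemma diffRatio_mono : Monotone (diffRatio u) := by
  refine monotone_nat_of_le_succ fun n => ?_
  rcases (sub_nonneg.2 (h.anti (n + 1))).eq_or_lt' with h1 | h1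
  · refine le_trans (le_of_eq ?_) (h.diffRatio_nonneg (n + 1))
    rw [diffRatio, show u (n + 1) - u (n + 2) = 0 from h1, zero_div]
  · have h0 : 0 < u n - u (n + 1) := h1.trans_le (h.diff_anti n)
    rw [diffRatio, diffRatio, div_le_div_iff₀ h0 h1]
    have := h.diff_log n
    have e : u (n + 1) - u (n + 1 + 1) = u (n + 1) - u (n + 2) := rfl
    have e2 : u (n + 1 + 1) - u (n + 1 + 2) = u (n + 2) - u (n + 3) := rfl
    rw [e, e2]
    linarith

/-- The ratio `u_{n+1} / u_n` is at least the ratio of the differences. -/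
lemma diffRatio_mul_le (n : ℕ) : diffRatio u n * u n ≤ u (n + 1) := by
  -- `m ↦ u_{m+1} - ρ_n u_m` is non-increasing for `m ≥ n`, with a non-negative limit
  have hanti : Antitone u := antitone_nat_of_succ_le h.anti
  have hbdd : BddBelow (range u) := ⟨0, by rintro _ ⟨n, rfl⟩; exact (h.pos n).le⟩
  have hlim := tendsto_atTop_ciInf hanti hbdd
  have hinf : 0 ≤ ⨅ i, u i := le_ciInf fun n => (h.pos n).le
  have hA : ∀ m, u (n + m + 1) - diffRatio u n * u (n + m) ≤ u (n + 1) - diffRatio u n * u n := by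
    intro m
    induction m with
    | zero => simp
    | succ m ih =>
      refine le_trans ?_ ih
      have e := h.diff_succ (n + m)
      have hm := h.diffRatio_mono (Nat.le_add_right n m)
      have := mul_le_mul_of_nonneg_right hm (sub_nonneg.2 (h.anti (n + m)))
      rw [show n + (m + 1) = n + m + 1 from rfl]
      have e2 : u (n + m + 1 + 1) = u (n + m + 2) := rfl
      rw [e2]
      nlinarith
  have h1 : Filter.Tendsto (fun m => u (n + m + 1) - diffRatio u n * u (n + m)) Filter.atTop
      (nhds ((⨅ i, u i) - diffRatio u n * ⨅ i, u i)) := by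
    refine Filter.Tendsto.sub ?_ (Filter.Tendsto.const_mul _ ?_)
    · exact hlim.comp (Filter.tendsto_atTop_mono (fun m => show m ≤ _ by omega) Filter.tendsto_id)
    · exact hlim.comp (Filter.tendsto_atTop_mono (fun m => show m ≤ _ by omega) Filter.tendsto_id)
  have h2 := le_of_tendsto' h1 hA
  have h3 := mul_nonneg (sub_nonneg.2 (h.diffRatio_le_one n)) hinf
  nlinarith

lemma ratio_mono : Monotone fun n => u (n + 1) / u n := by
  refine monotone_nat_of_le_succ fun n => ?_
  rw [div_le_div_iff₀ (h.pos _) (h.pos _)]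
  have e := h.diff_succ n
  have h1 := h.diffRatio_mul_le n
  have h2 := mul_le_mul_of_nonneg_left h1 (sub_nonneg.2 (h.anti n))
  have e2 : u (n + 1 + 1) = u (n + 2) := rfl
  rw [e2, show u (n + 2) = u (n + 1) - diffRatio u n * (u n - u (n + 1)) by linarith]
  nlinarith

lemma recip_nonpos (n : ℕ) : 0 ≤ -recipCoeff u (n + 1) :=
  recipCoeff_succ_nonpos h.pos h.ratio_mono n

/-- The recursion of `recipCoeff_succ` in terms of the differences of `u`. -/
lemma recipCoeff_diff (n : ℕ) :
    -recipCoeff u (n + 2) * u 0 = ∑ k ∈ Finset.range (n + 1), -recipCoeff u (k + 1) *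
      (u (n - k) - u (n - k + 1)) - recipCoeff u 0 * (u (n + 1) - u (n + 2)) := by
  have h0 : u 0 ≠ 0 := (h.pos 0).ne'
  have h1 := recipCoeff_succ h0 (n + 1)
  have h2 := recipCoeff_succ h0 n
  have e : ∑ k ∈ Finset.range (n + 1), -recipCoeff u (k + 1) * (u (n - k) - u (n - k + 1)) =
      ∑ k ∈ Finset.range (n + 1), -recipCoeff u (k + 1) * u (n - k) -
      ∑ k ∈ Finset.range (n + 1), -recipCoeff u (k + 1) * u (n + 1 - k) := by
    rw [← Finset.sum_sub_distrib]
    refine Finset.sum_congr rfl fun k hk => ?_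
    have := Finset.mem_range.1 hk
    rw [show n + 1 - k = n - k + 1 by omega]
    ring
  rw [e, Finset.sum_range_succ (fun k => -recipCoeff u (k + 1) * u (n - k)), Nat.sub_self]
  rw [show n + 2 = n + 1 + 1 from rfl]
  linarith

/-- The reciprocal coefficients are non-decreasing from index `1` on. -/
lemma recip_mono (n : ℕ) : recipCoeff u (n + 1) ≤ recipCoeff u (n + 2) := by
  have h0 : u 0 ≠ 0 := (h.pos 0).ne'
  have hz := recipCoeff_zero h0
  induction n using Nat.strong_induction_on with
  | _ n ih =>
    have hmono : ∀ k ≤ n, -recipCoeff u (n + 1) ≤ -recipCoeff u (k + 1) := by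
      intro k hk
      have : ∀ m, k + m ≤ n → -recipCoeff u (k + m + 1) ≤ -recipCoeff u (k + 1) := by
        intro m
        induction m with
        | zero => simp
        | succ m im =>
          intro hm
          have := ih (k + m) (by omega)
          exact (neg_le_neg this).trans (im (by omega))
      have := this (n - k) (by omega)
      rwa [show k + (n - k) + 1 = n + 1 by omega] at this
    have hA := h.recipCoeff_diff n
    set ρ := diffRatio u n with hρ
    have hv := h.diff_succ n
    have hm1 := h.diffRatio_mul_le n
    have hf := h.recip_nonpos n
    -- the same recursion one step earlier, with the boundary term at `n = 0`
    have hB : ∑ k ∈ Finset.range n, -recipCoeff u (k + 1) * (u (n - 1 - k) - u (n - k)) -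
        recipCoeff u 0 * (u n - u (n + 1)) ≤ -recipCoeff u (n + 1) * u 0 := by
      rcases n with _ | n
      · have := recipCoeff_succ h0 0
        simp only [Finset.range_zero, Finset.sum_empty] at this ⊢
        simp only [zero_add] at this ⊢
        linarith
      · have := h.recipCoeff_diff n
        rw [show n + 1 + 1 = n + 2 from rfl, this]
        refine le_of_eq ?_
        congr 1
        refine Finset.sum_congr rfl fun k hk => ?_
        have := Finset.mem_range.1 hk
        rw [show n + 1 - 1 - k = n - k by omega, show n + 1 - k = n - k + 1 by omega]
    have hB' := mul_le_mul_of_nonneg_left hB (h.diffRatio_nonneg n)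
    rw [← hρ] at hB'
    -- the terms with `k < n` are bounded below by their values for `f_k = f_n`
    have hsum : -recipCoeff u (n + 1) * (ρ * (u 0 - u n) - (u 1 - u (n + 1))) ≤
        ∑ k ∈ Finset.range n, -recipCoeff u (k + 1) *
          (ρ * (u (n - 1 - k) - u (n - k)) - (u (n - k) - u (n - k + 1))) := by
      have ht : ρ * (u 0 - u n) - (u 1 - u (n + 1)) = ∑ k ∈ Finset.range n,
          (ρ * (u (n - 1 - k) - u (n - k)) - (u (n - k) - u (n - k + 1))) := by
        rw [← Finset.sum_range_reflect, ← Finset.sum_range_sub' u n]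
        rw [show u 1 - u (n + 1) = ∑ i ∈ Finset.range n, (u (i + 1) - u (i + 1 + 1)) from
          (Finset.sum_range_sub' (fun i => u (i + 1)) n).symm, Finset.mul_sum,
          ← Finset.sum_sub_distrib]
        refine Finset.sum_congr rfl fun k hk => ?_
        have := Finset.mem_range.1 hk
        rw [show n - 1 - (n - 1 - k) = k by omega, show n - (n - 1 - k) = k + 1 by omega]
      rw [ht, Finset.mul_sum]
      refine Finset.sum_le_sum fun k hk => ?_
      have hk := Finset.mem_range.1 hk
      refine mul_le_mul_of_nonneg_right (hmono k hk.le) ?_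
      have e := h.diff_succ (n - 1 - k)
      rw [show n - 1 - k + 1 = n - k by omega, show n - 1 - k + 2 = n - k + 1 by omega] at e
      rw [e, ← sub_mul]
      have h1 := h.anti (n - 1 - k)
      rw [show n - 1 - k + 1 = n - k by omega] at h1
      exact mul_nonneg (sub_nonneg.2 (h.diffRatio_mono (by omega))) (sub_nonneg.2 h1)
    have hsplit : ∑ k ∈ Finset.range n, -recipCoeff u (k + 1) *
          (ρ * (u (n - 1 - k) - u (n - k)) - (u (n - k) - u (n - k + 1))) =
        ρ * ∑ k ∈ Finset.range n, -recipCoeff u (k + 1) * (u (n - 1 - k) - u (n - k)) -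
        ∑ k ∈ Finset.range n, -recipCoeff u (k + 1) * (u (n - k) - u (n - k + 1)) := by
      rw [Finset.mul_sum, ← Finset.sum_sub_distrib]
      refine Finset.sum_congr rfl fun k _ => ?_
      ring
    rw [Finset.sum_range_succ, Nat.sub_self, zero_add] at hA
    have hfin := mul_nonneg hf (sub_nonneg.2 hm1)
    have hgoal : 0 ≤ (-recipCoeff u (n + 1) - -recipCoeff u (n + 2)) * u 0 := by
      rw [sub_mul, hA, hv]
      rw [hsplit] at hsum
      nlinarith
    have := nonneg_of_mul_nonneg_left hgoal (h.pos 0)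
    linarith

lemma conj_anti : Antitone (conjCoeff u) := by
  refine antitone_nat_of_succ_le fun n => ?_
  rw [conjCoeff, conjCoeff, Finset.sum_range_succ _ (n + 1)]
  have := h.recip_nonpos n
  linarith

lemma conj_convex (n : ℕ) :
    conjCoeff u (n + 1) - conjCoeff u n ≤ conjCoeff u (n + 2) - conjCoeff u (n + 1) := by
  simp only [conjCoeff]
  rw [Finset.sum_range_succ _ (n + 2), Finset.sum_range_succ _ (n + 1)]
  have := h.recip_mono n
  linarith

lemma conj_nonneg (n : ℕ) : 0 ≤ conjCoeff u n := by
  have h0 : u 0 ≠ 0 := (h.pos 0).ne'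
  induction n using Nat.strong_induction_on with
  | _ n ih =>
    rcases n with _ | n
    · have := recipCoeff_zero h0
      have h1 : 0 < recipCoeff u 0 * u 0 := by rw [this]; norm_num
      simpa [conjCoeff] using nonneg_of_mul_nonneg_left h1.le (h.pos 0)
    · have h1 := sum_conjCoeff_mul h0 n
      have h2 := sum_conjCoeff_mul h0 (n + 1)
      rw [Finset.sum_range_succ, Nat.sub_self] at h2
      have h3 : ∑ k ∈ Finset.range (n + 1), conjCoeff u k * u (n + 1 - k) ≤
          ∑ k ∈ Finset.range (n + 1), conjCoeff u k * u (n - k) := by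
        refine Finset.sum_le_sum fun k hk => ?_
        have hk := Finset.mem_range.1 hk
        refine mul_le_mul_of_nonneg_left ?_ (ih k hk)
        rw [show n + 1 - k = n - k + 1 by omega]
        exact h.anti _
      refine nonneg_of_mul_nonneg_left ?_ (h.pos 0)
      linarith

end LogConvexDiff

end Kaluza

/-! ### Laplace transforms of step functions -/

/-- The Laplace transform `∫_0^∞ e^{-θx} f(x) dx` of a non-negative function, as an element
of `[0, ∞]`. -/
noncomputable def laplace (f : ℝ → ℝ) (θ : ℝ) : ℝ≥0∞ :=
  ∫⁻ x in Ioi (0 : ℝ), ENNReal.ofReal (Real.exp (-θ * x) * f x)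

/-- The step function with value `c n` on `[nε, (n+1)ε)`. -/
noncomputable def stepFun (ε : ℝ) (c : ℕ → ℝ) (x : ℝ) : ℝ := c ⌊x / ε⌋₊

lemma floor_div_eq {ε x : ℝ} (hε : 0 < ε) {n : ℕ} (hx : x ∈ Ico (n * ε) ((n + 1) * ε)) :
    ⌊x / ε⌋₊ = n := by
  have h0 : 0 ≤ x := le_trans (by positivity) hx.1
  rw [Nat.floor_eq_iff (by positivity), le_div_iff₀ hε, div_lt_iff₀ hε]
  exact hx

lemma floor_div_mul_le {ε x : ℝ} (hε : 0 < ε) (hx : 0 ≤ x) : ⌊x / ε⌋₊ * ε ≤ x := by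
  rw [← le_div_iff₀ hε]
  exact Nat.floor_le (by positivity)

lemma lt_floor_div_mul {ε : ℝ} (x : ℝ) (hε : 0 < ε) : x < (⌊x / ε⌋₊ + 1) * ε := by
  rw [← div_lt_iff₀ hε]
  exact Nat.lt_floor_add_one _

lemma measurable_stepFun (ε : ℝ) (c : ℕ → ℝ) : Measurable (stepFun ε c) :=
  (measurable_from_nat (f := c)).comp (Nat.measurable_floor.comp (measurable_id.div_const ε))

lemma lintegral_Ioi_eq_tsum {ε : ℝ} (hε : 0 < ε) (G : ℝ → ℝ≥0∞) :
    ∫⁻ x in Ioi (0 : ℝ), G x = ∑' n : ℕ, ∫⁻ x in Ico (n * ε) ((n + 1) * ε), G x := by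
  have hU : Ici (0 : ℝ) = ⋃ n : ℕ, Ico (n * ε) ((n + 1) * ε) := by
    ext x
    simp only [mem_Ici, mem_iUnion]
    constructor
    · intro hx
      exact ⟨⌊x / ε⌋₊, floor_div_mul_le hε hx, lt_floor_div_mul x hε⟩
    · rintro ⟨n, hn⟩
      exact le_trans (by positivity) hn.1
  rw [setLIntegral_congr Ioi_ae_eq_Ici, hU, lintegral_iUnion (fun _ => measurableSet_Ico)]
  intro m n hmn
  refine Set.disjoint_left.2 fun x hm hn => hmn ?_
  rw [← floor_div_eq hε hm, ← floor_div_eq hε hn]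

lemma lintegral_exp_Ico {θ : ℝ} (hθ : 0 < θ) {a b : ℝ} (hab : a ≤ b) :
    ∫⁻ x in Ico a b, ENNReal.ofReal (Real.exp (-θ * x)) =
      ENNReal.ofReal ((Real.exp (-θ * a) - Real.exp (-θ * b)) / θ) := by
  rw [setLIntegral_congr Ico_ae_eq_Ioc, ← ofReal_integral_eq_lintegral_ofReal,
    ← intervalIntegral.integral_of_le hab]
  · congr 1
    have : ∀ x ∈ uIcc a b, HasDerivAt (fun x => -Real.exp (-θ * x) / θ) (Real.exp (-θ * x)) x := by
      intro x _
      have h := (((hasDerivAt_id x).const_mul (-θ)).exp.neg).div_const θ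
      rw [show -(Real.exp (-θ * id x) * (-θ * 1)) / θ = Real.exp (-θ * x) by
        simp only [id]; field_simp] at h
      exact h
    rw [intervalIntegral.integral_eq_sub_of_hasDerivAt this
      ((by fun_prop : Continuous fun x => Real.exp (-θ * x)).intervalIntegrable _ _)]
    ring
  · exact (by fun_prop : Continuous fun x => Real.exp (-θ * x)).integrableOn_Ioc
  · exact Eventually.of_forall fun x => (Real.exp_pos _).le

lemma lintegral_exp_Ioi {θ : ℝ} (hθ : 0 < θ) (a : ℝ) :
    ∫⁻ x in Ioi a, ENNReal.ofReal (Real.exp (-θ * x)) =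
      ENNReal.ofReal (Real.exp (-θ * a) / θ) := by
  rw [← ofReal_integral_eq_lintegral_ofReal (integrableOn_exp_mul_Ioi (neg_neg_of_pos hθ) a)
    (Eventually.of_forall fun x => (Real.exp_pos _).le), integral_exp_mul_Ioi (neg_neg_of_pos hθ)]
  congr 1
  field_simp

lemma laplace_const {θ : ℝ} (hθ : 0 < θ) {a : ℝ} (ha : 0 ≤ a) :
    laplace (fun _ => a) θ = ENNReal.ofReal (a / θ) := by
  rw [laplace]
  simp_rw [mul_comm (Real.exp _) a, ENNReal.ofReal_mul ha]
  rw [lintegral_const_mul _ (by fun_prop), lintegral_exp_Ioi hθ, ← ENNReal.ofReal_mul ha]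
  simp [div_eq_mul_inv]

lemma summable_mul_exp {c : ℕ → ℝ} (h0 : ∀ n, 0 ≤ c n) (hc : Antitone c) {z : ℝ} (hz0 : 0 ≤ z)
    (hz : z < 1) : Summable fun n => c n * z ^ n :=
  Summable.of_nonneg_of_le (fun n => mul_nonneg (h0 n) (pow_nonneg hz0 n))
    (fun n => mul_le_mul_of_nonneg_right (hc (Nat.zero_le n)) (pow_nonneg hz0 n))
    ((summable_geometric_of_lt_one hz0 hz).mul_left _)

/-- The Laplace transform of a step function is a power series in `e^{-θε}`. -/
lemma laplace_stepFun {ε θ : ℝ} (hε : 0 < ε) (hθ : 0 < θ) {c : ℕ → ℝ} (h0 : ∀ n, 0 ≤ c n)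
    (hc : Antitone c) :
    laplace (stepFun ε c) θ = ENNReal.ofReal
      ((1 - Real.exp (-θ * ε)) / θ * ∑' n, c n * Real.exp (-θ * ε) ^ n) := by
  have hz : Real.exp (-θ * ε) < 1 := by
    rw [Real.exp_lt_one_iff]; nlinarith
  have hz0 : 0 ≤ (1 - Real.exp (-θ * ε)) / θ := div_nonneg (by linarith) hθ.le
  rw [laplace, lintegral_Ioi_eq_tsum hε, ENNReal.ofReal_mul hz0, ENNReal.ofReal_tsum_of_nonneg
    (fun n => mul_nonneg (h0 n) (by positivity)) (summable_mul_exp h0 hc (by positivity) hz),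
    ← ENNReal.tsum_mul_left]
  refine tsum_congr fun n => ?_
  have : ∀ x ∈ Ico (n * ε) ((n + 1) * ε), ENNReal.ofReal (Real.exp (-θ * x) * stepFun ε c x) =
      ENNReal.ofReal (c n) * ENNReal.ofReal (Real.exp (-θ * x)) := by
    intro x hx
    rw [stepFun, floor_div_eq hε hx, mul_comm, ENNReal.ofReal_mul (h0 n)]
  rw [setLIntegral_congr_fun measurableSet_Ico this, lintegral_const_mul _ (by fun_prop),
    lintegral_exp_Ico hθ (by nlinarith), ← ENNReal.ofReal_mul (h0 n), ← ENNReal.ofReal_mul hz0]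
  congr 1
  rw [← Real.exp_nat_mul, show -θ * ((n + 1) * ε) = (n * (-θ * ε)) + (-θ * ε) by ring,
    Real.exp_add, show -θ * (n * ε) = n * (-θ * ε) by ring]
  ring

/-! ### Subsequential limits of convex step functions -/

section Convex

variable {c : ℕ → ℝ}

/-- The three-chord inequality for a convex sequence. -/
lemma convex_seq_chord (hc : ∀ n, c (n + 1) - c n ≤ c (n + 2) - c (n + 1)) {i j m : ℕ}
    (hij : i ≤ j) (hjm : j ≤ m) :
    ((m : ℝ) - j) * (c j - c i) ≤ ((j : ℝ) - i) * (c m - c j) := by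
  have hmono : Monotone fun n => c (n + 1) - c n := monotone_nat_of_le_succ hc
  have h1 : c j - c i ≤ ((j : ℝ) - i) * (c (j + 1) - c j) := by
    obtain ⟨k, rfl⟩ := Nat.exists_eq_add_of_le hij
    have : c (i + k) - c i = ∑ l ∈ Finset.range k, (c (i + (l + 1)) - c (i + l)) := by
      rw [Finset.sum_range_sub (fun l => c (i + l))]; simp
    rw [this]
    have := Finset.sum_le_card_nsmul (Finset.range k) (fun l => c (i + (l + 1)) - c (i + l))
      (c (i + k + 1) - c (i + k)) fun l hl => hmono (a := i + l) (by
        have := Finset.mem_range.1 hl; omega)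
    simpa using this
  have h2 : ((m : ℝ) - j) * (c (j + 1) - c j) ≤ c m - c j := by
    obtain ⟨k, rfl⟩ := Nat.exists_eq_add_of_le hjm
    have : c (j + k) - c j = ∑ l ∈ Finset.range k, (c (j + (l + 1)) - c (j + l)) := by
      rw [Finset.sum_range_sub (fun l => c (j + l))]; simp
    rw [this]
    have := Finset.card_nsmul_le_sum (Finset.range k) (fun l => c (j + (l + 1)) - c (j + l))
      (c (j + 1) - c j) fun l hl => hmono (show j ≤ j + l by omega)
    simpa using this
  have hi : (i : ℝ) ≤ j := by exact_mod_cast hij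
  have hm : (j : ℝ) ≤ m := by exact_mod_cast hjm
  nlinarith [mul_le_mul_of_nonneg_left h1 (sub_nonneg.2 hm),
    mul_le_mul_of_nonneg_left h2 (sub_nonneg.2 hi)]

lemma stepFun_anti {ε : ℝ} (hε : 0 < ε) (hc : Antitone c) : Antitone (stepFun ε c) :=
  fun x y hxy => hc (Nat.floor_mono (by gcongr))

lemma stepFun_le {ε x : ℝ} (hε : 0 < ε) (h0 : ∀ n, 0 ≤ c n) (hc : Antitone c) (hx : 0 < x) {B : ℝ}
    (hB0 : 0 ≤ B) (hB : laplace (stepFun ε c) 1 ≤ ENNReal.ofReal B) :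
    stepFun ε c x ≤ B * Real.exp x / x := by
  have h1 : ENNReal.ofReal (Real.exp (-x) * stepFun ε c x) * ENNReal.ofReal x ≤
      laplace (stepFun ε c) 1 := by
    calc _ = ∫⁻ y in Ioc 0 x, ENNReal.ofReal (Real.exp (-x) * stepFun ε c x) := by simp
      _ ≤ ∫⁻ y in Ioc 0 x, ENNReal.ofReal (Real.exp (-1 * y) * stepFun ε c y) := by
        refine setLIntegral_mono' measurableSet_Ioc fun y hy => ENNReal.ofReal_le_ofReal ?_
        refine mul_le_mul (Real.exp_le_exp.2 (by linarith [hy.2])) (stepFun_anti hε hc hy.2)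
          (h0 _) (Real.exp_pos _).le
      _ ≤ _ := lintegral_mono_set fun y hy => hy.1
  have hnn : 0 ≤ stepFun ε c x := h0 _
  rw [← ENNReal.ofReal_mul (mul_nonneg (Real.exp_pos _).le hnn)] at h1
  have h2 := (ENNReal.ofReal_le_ofReal_iff hB0).1 (h1.trans hB)
  rw [le_div_iff₀ hx]
  have := mul_le_mul_of_nonneg_left h2 (Real.exp_pos x).le
  calc stepFun ε c x * x = Real.exp x * (Real.exp (-x) * stepFun ε c x * x) := by
        rw [Real.exp_neg]; field_simp
    _ ≤ _ := by linarith

end Convex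

lemma tendsto_floor_div_mul {ι : Type*} {l : Filter ι} {ε : ι → ℝ} (hε : ∀ k, 0 < ε k)
    (hlim : Tendsto ε l (𝓝 0)) {x : ℝ} (hx : 0 ≤ x) :
    Tendsto (fun k => (⌊x / ε k⌋₊ : ℝ) * ε k) l (𝓝 x) := by
  have h1 : Tendsto (fun k => x - ε k) l (𝓝 x) := by simpa using tendsto_const_nhds.sub hlim
  refine tendsto_of_tendsto_of_tendsto_of_le_of_le h1 tendsto_const_nhds (fun k => ?_) fun k =>
    floor_div_mul_le (hε k) hx
  have := lt_floor_div_mul x (hε k)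
  simp only
  linarith

/-- A Helly-type selection principle: locally bounded, non-increasing, convex sequences on lattices
whose mesh tends to `0` converge along a subsequence to a non-increasing convex function. -/
theorem exists_subseq_tendsto_convex {ε : ℕ → ℝ} (hε : ∀ k, 0 < ε k)
    (hlim : Tendsto ε atTop (𝓝 0)) {c : ℕ → ℕ → ℝ} (h0 : ∀ k n, 0 ≤ c k n)
    (hanti : ∀ k, Antitone (c k))
    (hconv : ∀ k n, c k (n + 1) - c k n ≤ c k (n + 2) - c k (n + 1))
    {M : ℝ → ℝ} (hM : ∀ k, ∀ x > 0, stepFun (ε k) (c k) x ≤ M x) :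
    ∃ φ : ℕ → ℕ, StrictMono φ ∧ ∃ C : ℝ → ℝ, ConvexOn ℝ (Ioi 0) C ∧ AntitoneOn C (Ioi 0) ∧
      (∀ x > 0, 0 ≤ C x) ∧
      ∀ x > 0, Tendsto (fun k => stepFun (ε (φ k)) (c (φ k)) x) atTop (𝓝 (C x)) := by
  -- a subsequence that converges at all positive rationals
  have hcomp : IsCompact (Set.univ.pi fun q : {q : ℚ // 0 < q} => Icc (0 : ℝ) (M q)) :=
    isCompact_univ_pi fun _ => isCompact_Icc
  obtain ⟨f, -, φ, hφ, hf⟩ := hcomp.tendsto_subseq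
    (x := fun k (q : {q : ℚ // 0 < q}) => stepFun (ε k) (c k) ((q : ℚ) : ℝ))
    (fun k q _ => ⟨h0 _ _, hM k _ (by exact_mod_cast q.2)⟩)
  rw [tendsto_pi_nhds] at hf
  have hεφ : Tendsto (fun k => ε (φ k)) atTop (𝓝 0) := hlim.comp hφ.tendsto_atTop
  set S : ℕ → ℝ → ℝ := fun k => stepFun (ε (φ k)) (c (φ k)) with hS
  have hSanti : ∀ k, Antitone (S k) := fun k => stepFun_anti (hε _) (hanti _)
  have hMnn : ∀ x > 0, 0 ≤ M x := fun x hx => (h0 _ _).trans (hM 0 x hx)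
  -- convexity makes the step functions equicontinuous up to the mesh size
  have hlip : ∀ x > 0, ∀ y ≥ x, ∀ k, (S k x - S k y) * (x / 2 - ε (φ k)) ≤
      (y - x + ε (φ k)) * M (x / 2) := by
    intro x hx y hxy k
    set e := ε (φ k)
    have he : 0 < e := hε _
    have hij : ⌊x / 2 / e⌋₊ ≤ ⌊x / e⌋₊ := Nat.floor_mono (by gcongr; linarith)
    have hjm : ⌊x / e⌋₊ ≤ ⌊y / e⌋₊ := Nat.floor_mono (by gcongr)
    have h1 := convex_seq_chord (hconv (φ k)) hij hjm
    have a1 := lt_floor_div_mul (x / 2) he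
    have a2 := floor_div_mul_le he (show 0 ≤ x / 2 by linarith)
    have b1 := lt_floor_div_mul x he
    have b2 := floor_div_mul_le he hx.le
    have d2 := floor_div_mul_le he (hx.le.trans hxy)
    have hS1 : S k x - S k y = c (φ k) ⌊x / e⌋₊ - c (φ k) ⌊y / e⌋₊ := rfl
    have hnn : 0 ≤ S k x - S k y := sub_nonneg.2 (hSanti k hxy)
    have hMx : c (φ k) ⌊x / 2 / e⌋₊ ≤ M (x / 2) := hM (φ k) (x / 2) (by linarith)
    have hpos : 0 ≤ c (φ k) ⌊x / e⌋₊ := h0 _ _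
    have hjm' : ((⌊x / e⌋₊ : ℝ)) ≤ ⌊y / e⌋₊ := by exact_mod_cast hjm
    calc (S k x - S k y) * (x / 2 - e)
        ≤ (S k x - S k y) * (((⌊x / e⌋₊ : ℝ) - ⌊x / 2 / e⌋₊) * e) :=
          mul_le_mul_of_nonneg_left (by linarith) hnn
      _ = e * (((⌊x / e⌋₊ : ℝ) - ⌊x / 2 / e⌋₊) * (c (φ k) ⌊x / e⌋₊ - c (φ k) ⌊y / e⌋₊)) := by
          rw [hS1]; ring
      _ ≤ e * (((⌊y / e⌋₊ : ℝ) - ⌊x / e⌋₊) * (c (φ k) ⌊x / 2 / e⌋₊ - c (φ k) ⌊x / e⌋₊)) :=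
          mul_le_mul_of_nonneg_left (by linarith) he.le
      _ ≤ e * (((⌊y / e⌋₊ : ℝ) - ⌊x / e⌋₊) * M (x / 2)) :=
          mul_le_mul_of_nonneg_left (mul_le_mul_of_nonneg_left (by linarith) (by linarith)) he.le
      _ = (((⌊y / e⌋₊ : ℝ) - ⌊x / e⌋₊) * e) * M (x / 2) := by ring
      _ ≤ _ := mul_le_mul_of_nonneg_right (by linarith) (hMnn _ (by linarith))
  have hcau : ∀ x > 0, ∃ l, Tendsto (fun k => S k x) atTop (𝓝 l) := by
    intro x hx
    refine cauchySeq_tendsto_of_complete (Metric.cauchySeq_iff.2 fun η hη => ?_)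
    set A := M (x / 2)
    have hA : 0 ≤ A := hMnn _ (by linarith)
    obtain ⟨q, hq1, hq2⟩ := exists_rat_btwn
      (show x < x + η * x / (32 * (A + 1)) from lt_add_of_pos_right _ (by positivity))
    have hq0 : 0 < q := by exact_mod_cast hx.trans hq1
    have hc := (hf ⟨q, hq0⟩).cauchySeq
    obtain ⟨N1, hN1⟩ := Metric.cauchySeq_iff.1 hc (η / 4) (by positivity)
    obtain ⟨N2, hN2⟩ := eventually_atTop.1 ((hεφ.eventually (gt_mem_nhds (sub_pos.2 hq1))).and
      (hεφ.eventually (gt_mem_nhds (show 0 < x / 4 by positivity))))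
    have hclose : ∀ k ≥ N2, S k x - S k q ≤ η / 4 := by
      intro k hk
      obtain ⟨e1, e2⟩ := hN2 k hk
      have h1 := hlip x hx q hq1.le k
      have hnn : 0 ≤ S k x - S k q := sub_nonneg.2 (hSanti k hq1.le)
      have h2 : (S k x - S k q) * (x / 4) ≤ (2 * (q - x)) * A :=
        (mul_le_mul_of_nonneg_left (by linarith) hnn).trans
          (h1.trans (mul_le_mul_of_nonneg_right (by linarith) hA))
      have h3 : (2 * (q - x)) * A ≤ η / 4 * (x / 4) := by
        have : ((q : ℝ) - x) * (32 * (A + 1)) < η * x := by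
          rw [← lt_div_iff₀ (by positivity)]; linarith
        nlinarith [sub_pos.2 hq1]
      exact le_of_mul_le_mul_right (h2.trans h3) (by positivity)
    refine ⟨max N1 N2, fun m hm n hn => ?_⟩
    have g1 := hclose m (le_of_max_le_right hm)
    have g2 := hclose n (le_of_max_le_right hn)
    have g3 : dist (S m q) (S n q) < η / 4 :=
      hN1 m (le_of_max_le_left hm) n (le_of_max_le_left hn)
    have k1 := hSanti m hq1.le
    have k2 := hSanti n hq1.le
    rw [Real.dist_eq, abs_lt] at g3 ⊢
    constructor <;> linarith [g3.1, g3.2]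
  choose! C hC using hcau
  refine ⟨φ, hφ, C, ?_, ?_, fun x hx => ge_of_tendsto' (hC x hx) fun k => h0 _ _, hC⟩
  · refine LinearOrder.convexOn_of_lt (convex_Ioi 0) fun x hx y hy hxy a b ha hb hab => ?_
    simp only [smul_eq_mul]
    have hx' : (0 : ℝ) < x := hx
    have hy' : (0 : ℝ) < y := hy
    set z := a * x + b * y with hz
    have hz0 : 0 < z := by positivity
    have hzx : z - x = b * (y - x) := by rw [hz, show a = 1 - b by linarith]; ring
    have hyz : y - z = a * (y - x) := by rw [hz, show b = 1 - a by linarith]; ring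
    have hxz : x ≤ z := by nlinarith
    have hzy : z ≤ y := by nlinarith
    have hl := fun {t : ℝ} (ht : 0 < t) => tendsto_floor_div_mul (fun k => hε (φ k)) hεφ ht.le
    have hlhs := ((hl hy').sub (hl hz0)).mul ((hC z hz0).sub (hC x hx'))
    have hrhs := ((hl hz0).sub (hl hx')).mul ((hC y hy').sub (hC z hz0))
    have hle := le_of_tendsto_of_tendsto' hlhs hrhs fun k => by
      have h1 := convex_seq_chord (hconv (φ k)) (i := ⌊x / ε (φ k)⌋₊) (j := ⌊z / ε (φ k)⌋₊)
        (m := ⌊y / ε (φ k)⌋₊) (Nat.floor_mono (by have := (hε (φ k)).le; gcongr))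
        (Nat.floor_mono (by have := (hε (φ k)).le; gcongr))
      have h2 := mul_le_mul_of_nonneg_left h1 (hε (φ k)).le
      simp only [hS, stepFun]
      linarith
    rw [hyz, hzx] at hle
    have hyx : 0 < y - x := sub_pos.2 hxy
    have h3 : a * (C z - C x) ≤ b * (C y - C z) := by
      refine le_of_mul_le_mul_right ?_ hyx
      linarith
    have h4 : C z = a * C z + b * C z := by rw [← add_mul, hab, one_mul]
    linarith
  · intro x hx y hy hxy
    exact le_of_tendsto_of_tendsto' (hC y hy) (hC x hx) fun k => hSanti k hxy

/-! ### Laplace transforms of monotone limits and the mass escaping to zero -/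

/-- If non-increasing functions converge pointwise and their Laplace transforms converge, then
the limit is the Laplace transform of the pointwise limit up to an additive constant, which is the
mass escaping to `0`. -/
theorem exists_laplace_limit {S : ℕ → ℝ → ℝ} (hSm : ∀ k, Measurable (S k))
    (hSanti : ∀ k, Antitone (S k)) {C M : ℝ → ℝ}
    (hM : ∀ k, ∀ x > 0, S k x ≤ M x)
    (hC : ∀ x > 0, Tendsto (fun k => S k x) atTop (𝓝 (C x)))
    {Ψ : ℝ → ℝ≥0∞} (hΨ : ∀ θ > 0, Tendsto (fun k => laplace (S k) θ) atTop (𝓝 (Ψ θ)))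
    (hfin : ∀ θ > 0, Ψ θ ≠ ∞) :
    ∃ d : ℝ, 0 ≤ d ∧ ∀ θ > 0, Ψ θ = ENNReal.ofReal d + laplace C θ := by
  set T : (ℝ → ℝ) → ℝ → ℝ → ℝ≥0∞ :=
    fun f δ θ => ∫⁻ x in Ioi δ, ENNReal.ofReal (Real.exp (-θ * x) * f x) with hT
  set I : (ℝ → ℝ) → ℝ → ℝ → ℝ≥0∞ :=
    fun f δ θ => ∫⁻ x in Ioc 0 δ, ENNReal.ofReal (Real.exp (-θ * x) * f x) with hI
  have hIT : ∀ f δ θ, 0 < δ → laplace f θ = I f δ θ + T f δ θ := by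
    intro f δ θ hδ
    rw [laplace, ← Ioc_union_Ioi_eq_Ioi hδ.le, lintegral_union measurableSet_Ioi
      (Set.disjoint_left.2 fun x hx hx' => not_lt.2 hx.2 hx')]
  have hbd : ∀ δ > 0, ∀ θ > 0, ∫⁻ x in Ioi δ, ENNReal.ofReal (Real.exp (-θ * x) * M δ) ≠ ∞ := by
    intro δ hδ θ hθ
    simp_rw [ENNReal.ofReal_mul (Real.exp_pos _).le]
    rw [lintegral_mul_const _ (by fun_prop), lintegral_exp_Ioi hθ]
    exact ENNReal.mul_ne_top ENNReal.ofReal_ne_top ENNReal.ofReal_ne_top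
  have hle : ∀ k, ∀ δ > 0, ∀ θ, ∀ x ∈ Ioi δ, ENNReal.ofReal (Real.exp (-θ * x) * S k x) ≤
      ENNReal.ofReal (Real.exp (-θ * x) * M δ) := fun k δ hδ θ x hx =>
    ENNReal.ofReal_le_ofReal (mul_le_mul_of_nonneg_left
      ((hSanti k (le_of_lt hx)).trans (hM k δ hδ)) (Real.exp_pos _).le)
  have hJ : ∀ δ > 0, ∀ θ > 0, Tendsto (fun k => T (S k) δ θ) atTop (𝓝 (T C δ θ)) := by
    intro δ hδ θ hθ
    refine tendsto_lintegral_of_dominated_convergence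
      (fun x => ENNReal.ofReal (Real.exp (-θ * x) * M δ)) (fun k => ?_)
      (fun k => (ae_restrict_iff' measurableSet_Ioi).2 (Eventually.of_forall (hle k δ hδ θ)))
      (hbd δ hδ θ hθ) ((ae_restrict_iff' measurableSet_Ioi).2 (Eventually.of_forall fun x hx => ?_))
    · have := hSm k
      fun_prop
    · exact ENNReal.tendsto_ofReal ((hC x (hδ.trans hx)).const_mul _)
  have hTfin : ∀ k, ∀ δ > 0, ∀ θ > 0, T (S k) δ θ ≠ ∞ := fun k δ hδ θ hθ =>
    ne_top_of_le_ne_top (hbd δ hδ θ hθ) (setLIntegral_mono' measurableSet_Ioi (hle k δ hδ θ))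
  have hD : ∀ δ > 0, ∀ θ > 0, Tendsto (fun k => I (S k) δ θ) atTop (𝓝 (Ψ θ - T C δ θ)) := by
    intro δ hδ θ hθ
    have := ENNReal.Tendsto.sub (hΨ θ hθ) (hJ δ hδ θ hθ) (Or.inl (hfin θ hθ))
    refine this.congr fun k => ?_
    rw [hIT _ δ θ hδ]
    exact ENNReal.add_sub_cancel_right (hTfin k δ hδ θ hθ)
  have hTle : ∀ δ > 0, ∀ θ > 0, T C δ θ ≤ Ψ θ := fun δ hδ θ hθ =>
    le_of_tendsto_of_tendsto' (hJ δ hδ θ hθ) (hΨ θ hθ) fun k =>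
      (hIT (S k) δ θ hδ).symm ▸ le_add_self
  set δ : ℕ → ℝ := fun n => 1 / ((n : ℝ) + 1) with hδ
  have hδ0 : ∀ n, 0 < δ n := fun n => Nat.one_div_pos_of_nat
  have hδl : Tendsto δ atTop (𝓝 0) := tendsto_one_div_add_atTop_nhds_zero_nat
  have hTlim : ∀ θ, Tendsto (fun n => T C (δ n) θ) atTop (𝓝 (laplace C θ)) := by
    intro θ
    have hmono : Monotone fun n => Ioi (δ n) := fun m n hmn =>
      Ioi_subset_Ioi (one_div_le_one_div_of_le (by positivity) (by gcongr))
    have hU : ⋃ n, Ioi (δ n) = Ioi 0 := by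
      ext x
      simp only [mem_iUnion, mem_Ioi]
      exact ⟨fun ⟨n, hn⟩ => (hδ0 n).trans hn, fun hx => (hδl.eventually (gt_mem_nhds hx)).exists⟩
    have := tendsto_measure_iUnion_atTop
      (μ := volume.withDensity fun x => ENNReal.ofReal (Real.exp (-θ * x) * C x)) hmono
    rw [hU, withDensity_apply _ measurableSet_Ioi] at this
    refine this.congr fun n => ?_
    rw [Function.comp, withDensity_apply _ measurableSet_Ioi]
  have hLle : ∀ θ > 0, laplace C θ ≤ Ψ θ := fun θ hθ =>
    le_of_tendsto' (hTlim θ) fun n => hTle _ (hδ0 n) θ hθ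
  have hDlim : ∀ θ > 0, Tendsto (fun n => Ψ θ - T C (δ n) θ) atTop (𝓝 (Ψ θ - laplace C θ)) :=
    fun θ hθ => ENNReal.Tendsto.sub tendsto_const_nhds (hTlim θ) (Or.inl (hfin θ hθ))
  -- near `0` the factors `e^{-θx}` do not depend on `θ` in the limit
  have hconst : ∀ θ > 0, ∀ θ' ≥ θ, Ψ θ - laplace C θ = Ψ θ' - laplace C θ' := by
    intro θ hθ θ' hθ'
    have hθ0 : 0 < θ' := hθ.trans_le hθ'
    have hSnn : ∀ k n, ∀ x ∈ Ioc 0 (δ n), ENNReal.ofReal (Real.exp (-θ' * x) * S k x) ≤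
        ENNReal.ofReal (Real.exp (-θ * x) * S k x) ∧
        ENNReal.ofReal (Real.exp (-θ * x) * S k x) ≤ ENNReal.ofReal (Real.exp ((θ' - θ) * δ n)) *
          ENNReal.ofReal (Real.exp (-θ' * x) * S k x) := by
      intro k n x hx
      rw [← ENNReal.ofReal_mul (Real.exp_pos _).le, ← mul_assoc, ← Real.exp_add]
      rcases le_total 0 (S k x) with h | h
      · exact ⟨ENNReal.ofReal_le_ofReal (mul_le_mul_of_nonneg_right
          (Real.exp_le_exp.2 (by nlinarith [hx.1])) h), ENNReal.ofReal_le_ofReal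
          (mul_le_mul_of_nonneg_right (Real.exp_le_exp.2 (by nlinarith [hx.2])) h)⟩
      · rw [ENNReal.ofReal_of_nonpos (mul_nonpos_of_nonneg_of_nonpos (Real.exp_pos _).le h),
          ENNReal.ofReal_of_nonpos (mul_nonpos_of_nonneg_of_nonpos (Real.exp_pos _).le h)]
        simp
    refine le_antisymm ?_ ?_
    · have h1 : ∀ n, Ψ θ - T C (δ n) θ ≤
          ENNReal.ofReal (Real.exp ((θ' - θ) * δ n)) * (Ψ θ' - T C (δ n) θ') := fun n =>
        le_of_tendsto_of_tendsto' (hD _ (hδ0 n) θ hθ)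
          (ENNReal.Tendsto.const_mul (hD _ (hδ0 n) θ' hθ0) (Or.inr ENNReal.ofReal_ne_top))
          fun k => by
            simp only [hI]
            rw [← lintegral_const_mul' _ _ ENNReal.ofReal_ne_top]
            exact setLIntegral_mono' measurableSet_Ioc fun x hx => (hSnn k n x hx).2
      have h2 : Tendsto (fun n => ENNReal.ofReal (Real.exp ((θ' - θ) * δ n))) atTop (𝓝 1) := by
        have : Tendsto (fun n => Real.exp ((θ' - θ) * δ n)) atTop (𝓝 1) := by
          have h := (hδl.const_mul (θ' - θ)).rexp
          simpa using h
        simpa using ENNReal.tendsto_ofReal this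
      have h3 := ENNReal.Tendsto.mul h2 (Or.inl one_ne_zero) (hDlim θ' hθ0)
        (Or.inr ENNReal.one_ne_top)
      rw [one_mul] at h3
      exact le_of_tendsto_of_tendsto' (hDlim θ hθ) h3 h1
    · exact le_of_tendsto_of_tendsto' (hDlim θ' hθ0) (hDlim θ hθ) fun n =>
        le_of_tendsto_of_tendsto' (hD _ (hδ0 n) θ' hθ0) (hD _ (hδ0 n) θ hθ) fun k =>
          setLIntegral_mono' measurableSet_Ioc fun x hx => (hSnn k n x hx).1
  refine ⟨(Ψ 1 - laplace C 1).toReal, ENNReal.toReal_nonneg, fun θ hθ => ?_⟩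
  rw [ENNReal.ofReal_toReal (ne_top_of_le_ne_top (hfin 1 one_pos) tsub_le_self)]
  have : Ψ 1 - laplace C 1 = Ψ θ - laplace C θ := by
    rcases le_total θ 1 with h | h
    · exact (hconst θ hθ 1 h).symm
    · exact hconst 1 one_pos θ h
  rw [this, tsub_add_cancel_of_le (hLle θ hθ)]

/-! ### Discretization of a density with log convex derivative -/

section Density

variable {w : ℝ → ℝ}

/-- A density on `(0, ∞)` that is differentiable and non-increasing and such that `-w'` is
non-increasing and log convex. -/
structure LogConvexDensity (w : ℝ → ℝ) : Prop where
  nonneg : ∀ x > 0, 0 ≤ w x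
  anti : AntitoneOn w (Ioi 0)
  diff : DifferentiableOn ℝ w (Ioi 0)
  deriv_anti : AntitoneOn (fun x => -deriv w x) (Ioi 0)
  deriv_log : Subord.LogConvexOn (Ioi 0) fun x => -deriv w x

namespace LogConvexDensity

variable (h : LogConvexDensity w)
include h

lemma hasDerivAt {x : ℝ} (hx : 0 < x) : HasDerivAt w (deriv w x) x :=
  (h.diff.differentiableAt (Ioi_mem_nhds hx)).hasDerivAt

lemma deriv_nonpos {x : ℝ} (hx : 0 < x) : 0 ≤ -deriv w x := h.deriv_log.2.1 x hx

/-- Either `w` vanishes identically on `(0, ∞)`, or it is positive. -/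
lemma eq_zero_or_pos : (∀ x > 0, w x = 0) ∨ ∀ x > 0, 0 < w x := by
  by_contra! hcon
  obtain ⟨⟨x1, hx1, hw1⟩, x0, hx0, hw0⟩ := hcon
  have hz : ∀ x ≥ x0, w x = 0 := fun x hx => le_antisymm
    ((h.anti hx0 (hx0.trans_le hx : (0 : ℝ) < x) hx).trans hw0) (h.nonneg x (hx0.trans_le hx))
  have hd : ∀ x > x0, deriv w x = 0 := by
    intro x hx
    have : w =ᶠ[𝓝 x] fun _ => 0 := by
      filter_upwards [Ioi_mem_nhds hx] with y hy using hz y (le_of_lt hy)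
    rw [this.deriv_eq, deriv_const]
  -- by log convexity the zeros of the derivative propagate to the left
  have hd' : ∀ x > 0, deriv w x = 0 := by
    intro x hx
    have hlog := h.deriv_log.2.2 (x / 2) (show (0 : ℝ) < x / 2 by positivity) (3 * x + x0 + x0)
      (show (0 : ℝ) < 3 * x + x0 + x0 by positivity)
    set y := 3 * x + x0 + x0 with hy
    have hxy : x < y := by linarith
    have hden : 0 < y - x / 2 := by linarith
    have h1 := hlog ((y - x) / (y - x / 2)) ((x / 2) / (y - x / 2))
      (div_pos (by linarith) hden) (div_pos (by linarith) hden) (by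
        rw [← add_div, div_eq_iff hden.ne']; ring)
    have e : (y - x) / (y - x / 2) * (x / 2) + (x / 2) / (y - x / 2) * y = x := by
      rw [div_mul_eq_mul_div, div_mul_eq_mul_div, ← add_div, div_eq_iff hden.ne']; ring
    simp only [e, hd y (by linarith), neg_zero] at h1
    rw [Real.zero_rpow (div_pos (by linarith) hden).ne', mul_zero] at h1
    linarith [h.deriv_nonpos hx]
  have hconst : w x1 = w x0 :=
    (convex_Ioi (0 : ℝ)).is_const_of_fderivWithin_eq_zero (𝕜 := ℝ) h.diff (fun x hx => by
      rw [fderivWithin_of_isOpen isOpen_Ioi hx]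
      ext
      simpa using hd' x hx) hx1 hx0
  exact hw1 (hconst.trans (hz x0 le_rfl))

lemma deriv_sq_le {x ε : ℝ} (hx : 0 < x - ε) (hε : 0 < ε) :
    deriv w x ^ 2 ≤ deriv w (x - ε) * deriv w (x + ε) := by
  have h1 := h.deriv_log.2.2 (x - ε) hx (x + ε) (show (0 : ℝ) < x + ε by linarith) (1 / 2) (1 / 2)
    (by norm_num) (by norm_num) (by norm_num)
  simp only [show (1 : ℝ) / 2 * (x - ε) + 1 / 2 * (x + ε) = x by ring, ← Real.sqrt_eq_rpow] at h1
  have hA := h.deriv_nonpos hx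
  have hB := h.deriv_nonpos (show 0 < x + ε by linarith)
  have hC := h.deriv_nonpos (show 0 < x by linarith)
  have h2 := mul_self_le_mul_self hC h1
  rw [mul_mul_mul_comm, Real.mul_self_sqrt hA, Real.mul_self_sqrt hB] at h2
  nlinarith

lemma diff_anti {x ε : ℝ} (hx : 0 < x) (hε : 0 < ε) :
    w (x + ε) - w (x + ε + ε) ≤ w x - w (x + ε) := by
  have hd : ∀ y ∈ Ioi (0 : ℝ), HasDerivAt (fun y => w y - w (y + ε))
      (deriv w y - deriv w (y + ε)) y := fun y hy =>
    (h.hasDerivAt hy).sub ((h.hasDerivAt (show 0 < y + ε from add_pos hy hε)).comp_add_const y ε)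
  have hanti : AntitoneOn (fun y => w y - w (y + ε)) (Ioi 0) := by
    refine antitoneOn_of_deriv_nonpos (convex_Ioi 0)
      (fun y hy => (hd y hy).continuousAt.continuousWithinAt)
      (fun y hy => (hd y (interior_subset hy)).differentiableAt.differentiableWithinAt)
      fun y hy => ?_
    have hy : y ∈ Ioi (0 : ℝ) := interior_subset hy
    rw [(hd y hy).deriv]
    have := h.deriv_anti hy (show y + ε ∈ Ioi (0 : ℝ) from add_pos hy hε) (by linarith)
    simp only at this
    linarith
  exact hanti hx (show (0 : ℝ) < x + ε by positivity) (by linarith)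

lemma diff_log {x ε : ℝ} (hx : 0 < x) (hε : 0 < ε) :
    (w (x + ε) - w (x + ε + ε)) ^ 2 ≤ (w x - w (x + ε)) * (w (x + ε + ε) - w (x + ε + ε + ε)) := by
  -- for each weight `s > 0` the function `y ↦ s w(y - ε) + w(y + ε) / s - 2 w(y)` is non-increasing
  have key : ∀ s > 0, 2 * (w (x + ε) - w (x + ε + ε)) ≤
      s * (w x - w (x + ε)) + (w (x + ε + ε) - w (x + ε + ε + ε)) / s := by
    intro s hs
    have hd : ∀ y ∈ Ioi ε, HasDerivAt (fun y => s * w (y - ε) + w (y + ε) / s - 2 * w y)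
        (s * deriv w (y - ε) + deriv w (y + ε) / s - 2 * deriv w y) y := fun y hy => by
      have hy : ε < y := hy
      exact ((((h.hasDerivAt (sub_pos.2 hy)).comp_sub_const y ε).const_mul s).add
        (((h.hasDerivAt (show 0 < y + ε by linarith)).comp_add_const y ε).div_const s)).sub
        ((h.hasDerivAt (hε.trans hy)).const_mul 2)
    have hanti : AntitoneOn (fun y => s * w (y - ε) + w (y + ε) / s - 2 * w y) (Ioi ε) := by
      refine antitoneOn_of_deriv_nonpos (convex_Ioi ε)
        (fun y hy => (hd y hy).continuousAt.continuousWithinAt)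
        (fun y hy => (hd y (interior_subset hy)).differentiableAt.differentiableWithinAt)
        fun y hy => ?_
      have hy : y ∈ Ioi ε := interior_subset hy
      have hy' : ε < y := hy
      rw [(hd y hy).deriv]
      have h1 := h.deriv_sq_le (sub_pos.2 hy') hε
      have hA := h.deriv_nonpos (sub_pos.2 hy')
      have hB := h.deriv_nonpos (show 0 < y + ε by linarith)
      set A := deriv w (y - ε)
      set B := deriv w (y + ε)
      set D := deriv w y
      have h2 : 2 * -D ≤ s * -A + -B / s := by
        have hnn := add_nonneg (mul_nonneg hs.le hA) (div_nonneg hB hs.le)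
        have e : (s * -A + -B / s) ^ 2 = (s * -A - -B / s) ^ 2 + 4 * (A * B) := by
          field_simp; ring
        have hsq : (2 * -D) ^ 2 ≤ (s * -A + -B / s) ^ 2 := by
          rw [e]
          nlinarith [sq_nonneg (s * -A - -B / s)]
        exact (le_abs_self _).trans (abs_le_of_sq_le_sq hsq hnn)
      have e : -B / s = -(B / s) := by ring
      rw [e] at h2
      linarith
    have := hanti (show x + ε ∈ Ioi ε from lt_add_of_pos_left _ hx)
      (show ε < x + ε + ε by linarith) (by linarith)
    simp only [add_sub_cancel_right] at this
    have e : (w (x + ε + ε) - w (x + ε + ε + ε)) / s =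
      w (x + ε + ε) / s - w (x + ε + ε + ε) / s := by ring
    rw [e]
    linarith
  have hx1 : (0 : ℝ) < x + ε := by positivity
  have hx2 : (0 : ℝ) < x + ε + ε := by positivity
  have hx3 : (0 : ℝ) < x + ε + ε + ε := by positivity
  have n0 : 0 ≤ w x - w (x + ε) := sub_nonneg.2 (h.anti hx hx1 (by linarith))
  have n1 : 0 ≤ w (x + ε) - w (x + ε + ε) := sub_nonneg.2 (h.anti hx1 hx2 (by linarith))
  have n2 : 0 ≤ w (x + ε + ε) - w (x + ε + ε + ε) := sub_nonneg.2 (h.anti hx2 hx3 (by linarith))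
  have hle := h.diff_anti hx hε
  set D0 := w x - w (x + ε)
  set D1 := w (x + ε) - w (x + ε + ε)
  set D2 := w (x + ε + ε) - w (x + ε + ε + ε)
  rcases n1.eq_or_lt' with h1 | h1
  · rw [h1]; nlinarith [mul_nonneg n0 n2]
  · have h0 : 0 < D0 := h1.trans_le hle
    have := key (D1 / D0) (div_pos h1 h0)
    have e : D1 / D0 * D0 = D1 := div_mul_cancel₀ _ h0.ne'
    rw [e] at this
    have h3 : D1 ≤ D2 / (D1 / D0) := by linarith
    rw [le_div_iff₀ (div_pos h1 h0)] at h3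
    have h4 := mul_le_mul_of_nonneg_right h3 h0.le
    rw [mul_assoc, e] at h4
    nlinarith

lemma logConvexDiff (hpos : ∀ x > 0, 0 < w x) {ε : ℝ} (hε : 0 < ε) {b : ℝ} (hb : 0 ≤ b) :
    LogConvexDiff fun n : ℕ => w ((n + 1) * ε) + if n = 0 then b else 0 := by
  have hx : ∀ n : ℕ, (0 : ℝ) < (n + 1) * ε := fun n => by positivity
  have e1 : ∀ n : ℕ, (((n + 1 : ℕ) : ℝ) + 1) * ε = (n + 1) * ε + ε := fun n => by push_cast; ring
  have hi : ∀ n : ℕ, 0 ≤ if n = 0 then b else 0 := fun n => by split_ifs <;> simp [hb]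
  have hanti : ∀ {x : ℝ}, 0 < x → w (x + ε) ≤ w x := fun hx =>
    h.anti hx (show (0 : ℝ) < _ + ε by positivity) (by linarith)
  refine ⟨fun n => add_pos_of_pos_of_nonneg (hpos _ (hx n)) (hi n), fun n => ?_, fun n => ?_,
    fun n => ?_⟩
  · simp only [e1, Nat.succ_ne_zero, if_false]
    linarith [hi n, hanti (hx n)]
  · simp only [e1, Nat.succ_ne_zero, if_false]
    linarith [hi n, h.diff_anti (hx n) hε]
  · simp only [e1, Nat.succ_ne_zero, if_false]
    have h1 := h.diff_log (hx n) hε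
    have h2 : w ((n + 1) * ε + ε + ε + ε) ≤ w ((n + 1) * ε + ε + ε) :=
      hanti (by have := hx n; positivity)
    nlinarith [mul_nonneg (hi n) (sub_nonneg.2 h2)]

/-- Riemann sums of the Laplace transform of `w`. -/
lemma tendsto_riemann {ε : ℕ → ℝ} (hε : ∀ k, 0 < ε k) (hε1 : ∀ k, ε k ≤ 1)
    (hlim : Tendsto ε atTop (𝓝 0)) {θ : ℝ} (hθ : 0 < θ) (hfin : laplace w θ ≠ ∞) :
    Tendsto (fun k => ∑' n : ℕ, ENNReal.ofReal (ε k * (w ((n + 1) * ε k) *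
      Real.exp (-θ * ε k) ^ n))) atTop (𝓝 (laplace w θ)) := by
  have hsum : ∀ k, ∑' n : ℕ, ENNReal.ofReal (ε k * (w ((n + 1) * ε k) *
      Real.exp (-θ * ε k) ^ n)) = ∫⁻ x in Ioi (0 : ℝ), ENNReal.ofReal
        (w ((⌊x / ε k⌋₊ + 1) * ε k) * Real.exp (-θ * ε k) ^ ⌊x / ε k⌋₊) := by
    intro k
    rw [lintegral_Ioi_eq_tsum (hε k)]
    refine tsum_congr fun n => ?_
    rw [setLIntegral_congr_fun measurableSet_Ico
      (g := fun _ => ENNReal.ofReal (w ((n + 1) * ε k) * Real.exp (-θ * ε k) ^ n))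
      (fun x hx => by simp only [floor_div_eq (hε k) hx]), setLIntegral_const, Real.volume_Ico,
      show ((n : ℝ) + 1) * ε k - n * ε k = ε k by ring, ENNReal.ofReal_mul (hε k).le, mul_comm]
  simp_rw [hsum]
  -- the factor relating the weights at the left and the right end points of the lattice cells
  have hpow : ∀ k x, Real.exp (-θ * ε k) ^ ⌊x / ε k⌋₊ =
      Real.exp (θ * ε k) * Real.exp (-θ * ((⌊x / ε k⌋₊ + 1) * ε k)) := by
    intro k x
    rw [← Real.exp_nat_mul, ← Real.exp_add]
    congr 1
    ring
  refine tendsto_lintegral_of_dominated_convergence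
    (fun x => ENNReal.ofReal (Real.exp θ) * ENNReal.ofReal (Real.exp (-θ * x) * w x))
    (fun k => ?_) (fun k => ?_) ?_ ?_
  · have h1 : Measurable fun x : ℝ => ⌊x / ε k⌋₊ :=
      Nat.measurable_floor.comp (measurable_id.div_const _)
    have h2 : Measurable fun n : ℕ => ENNReal.ofReal
        (w ((n + 1) * ε k) * Real.exp (-θ * ε k) ^ n) := measurable_from_nat
    exact h2.comp h1
  · refine (ae_restrict_iff' measurableSet_Ioi).2 (Eventually.of_forall fun x hx => ?_)
    have hx : 0 < x := hx
    have hlt := lt_floor_div_mul x (hε k)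
    simp only
    rw [← ENNReal.ofReal_mul (Real.exp_pos _).le]
    refine ENNReal.ofReal_le_ofReal ?_
    rw [hpow, mul_comm, mul_assoc]
    refine mul_le_mul (Real.exp_le_exp.2 (by nlinarith [hε1 k])) (mul_le_mul
      (Real.exp_le_exp.2 (by nlinarith)) (h.anti hx (hx.trans hlt) hlt.le)
      (h.nonneg _ (hx.trans hlt)) (Real.exp_pos _).le) ?_ (Real.exp_pos _).le
    exact mul_nonneg (Real.exp_pos _).le (h.nonneg _ (hx.trans hlt))
  · rw [lintegral_const_mul' _ _ ENNReal.ofReal_ne_top]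
    exact ENNReal.mul_ne_top ENNReal.ofReal_ne_top hfin
  · refine (ae_restrict_iff' measurableSet_Ioi).2 (Eventually.of_forall fun x hx => ?_)
    have hx : 0 < x := hx
    refine ENNReal.tendsto_ofReal ?_
    simp_rw [hpow]
    have hy : Tendsto (fun k => ((⌊x / ε k⌋₊ : ℝ) + 1) * ε k) atTop (𝓝 x) := by
      simp_rw [add_mul, one_mul]
      simpa using (tendsto_floor_div_mul hε hlim hx.le).add hlim
    have h1 := ((h.hasDerivAt hx).continuousAt.tendsto.comp hy).mul
      ((hlim.const_mul θ).rexp.mul (hy.const_mul (-θ)).rexp)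
    simpa [Function.comp_def, mul_comm] using h1

end LogConvexDensity

end Density

/-! ### The reciprocal of the Laplace transform -/

lemma LogConvexDiff.tsum_conj_mul {u : ℕ → ℝ} (hu : LogConvexDiff u) {z : ℝ} (hz0 : 0 ≤ z)
    (hz : z < 1) : (1 - z) * (∑' n, conjCoeff u n * z ^ n) * ∑' n, u n * z ^ n = 1 := by
  have hanti : Antitone u := antitone_nat_of_succ_le hu.anti
  have s1 := summable_mul_exp hu.conj_nonneg hu.conj_anti hz0 hz
  have s2 := summable_mul_exp (fun n => (hu.pos n).le) hanti hz0 hz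
  rw [mul_assoc, tsum_mul_tsum_eq_tsum_sum_range_of_summable_norm s1.norm s2.norm]
  have : ∀ n, ∑ k ∈ Finset.range (n + 1), conjCoeff u k * z ^ k * (u (n - k) * z ^ (n - k)) =
      z ^ n := by
    intro n
    rw [← one_mul (z ^ n), ← sum_conjCoeff_mul (hu.pos 0).ne' n, Finset.sum_mul]
    refine Finset.sum_congr rfl fun k hk => ?_
    have hk := Finset.mem_range.1 hk
    rw [mul_mul_mul_comm, ← pow_add, Nat.add_sub_cancel' (by omega)]
  simp_rw [this]
  rw [tsum_geometric_of_lt_one hz0 hz, mul_inv_cancel₀ (by linarith)]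

lemma laplace_conj {u : ℕ → ℝ} (hu : LogConvexDiff u) {ε θ : ℝ} (hε : 0 < ε) (hθ : 0 < θ) :
    laplace (stepFun ε fun n => conjCoeff u n / ε) θ =
      (ENNReal.ofReal θ * ENNReal.ofReal (ε * ∑' n, u n * Real.exp (-θ * ε) ^ n))⁻¹ := by
  set z := Real.exp (-θ * ε) with hz
  have hz1 : z < 1 := by rw [hz, Real.exp_lt_one_iff]; nlinarith
  have hz0 : 0 ≤ z := (Real.exp_pos _).le
  have hanti : Antitone u := antitone_nat_of_succ_le hu.anti
  have hpos : 0 < ∑' n, u n * z ^ n :=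
    (summable_mul_exp (fun n => (hu.pos n).le) hanti hz0 hz1).tsum_pos
      (fun n => mul_nonneg (hu.pos n).le (pow_nonneg hz0 n)) 0 (by simpa using hu.pos 0)
  rw [laplace_stepFun hε hθ (fun n => div_nonneg (hu.conj_nonneg n) hε.le)
    (fun m n hmn => div_le_div_of_nonneg_right (hu.conj_anti hmn) hε.le),
    ← ENNReal.ofReal_mul hθ.le, ← ENNReal.ofReal_inv_of_pos (by positivity)]
  congr 1
  have h1 := hu.tsum_conj_mul hz0 hz1
  simp_rw [← hz, div_mul_eq_mul_div, tsum_div_const]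
  refine eq_inv_of_mul_eq_one_left ?_
  field_simp
  exact h1

/-- If `-w'` is non-increasing and log convex, then `1 / (θ (a + ∫_0^∞ e^{-θx} w(x) dx))` is the
Laplace transform of a measure on `[0, ∞)` which has a non-increasing convex density on `(0, ∞)`,
and possibly an atom at `0`. -/
theorem LogConvexDensity.exists_convex {w : ℝ → ℝ} (h : LogConvexDensity w) {a : ℝ} (ha : 0 ≤ a)
    (hfin : ∀ θ > 0, laplace w θ ≠ ∞) (hpos : ∀ θ > 0, ENNReal.ofReal a + laplace w θ ≠ 0) :
    ∃ d : ℝ, 0 ≤ d ∧ ∃ C : ℝ → ℝ, ConvexOn ℝ (Ioi 0) C ∧ AntitoneOn C (Ioi 0) ∧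
      (∀ x > 0, 0 ≤ C x) ∧ ∀ θ > 0,
        (ENNReal.ofReal θ * (ENNReal.ofReal a + laplace w θ))⁻¹ =
          ENNReal.ofReal d + laplace C θ := by
  rcases h.eq_zero_or_pos with hw | hw
  · have hL : ∀ θ, laplace w θ = 0 := fun θ => by
      rw [laplace, setLIntegral_congr_fun measurableSet_Ioi (g := fun _ => 0)
        (fun x hx => by simp [hw x hx])]
      simp
    have ha' : 0 < a := by
      have := hpos 1 one_pos
      rw [hL, add_zero, ne_eq, ENNReal.ofReal_eq_zero, not_le] at this
      exact this
    refine ⟨0, le_rfl, fun _ => 1 / a, convexOn_const _ (convex_Ioi 0), antitoneOn_const,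
      fun _ _ => by positivity, fun θ hθ => ?_⟩
    rw [hL, laplace_const hθ (by positivity), ENNReal.ofReal_zero, zero_add, add_zero,
      ← ENNReal.ofReal_mul hθ.le, ← ENNReal.ofReal_inv_of_pos (by positivity)]
    congr 1
    field_simp
  set ε : ℕ → ℝ := fun k => 1 / ((k : ℝ) + 1) with hεdef
  have hε : ∀ k, 0 < ε k := fun k => Nat.one_div_pos_of_nat
  have hlim : Tendsto ε atTop (𝓝 0) := tendsto_one_div_add_atTop_nhds_zero_nat
  have hε1 : ∀ k, ε k ≤ 1 := fun k => by
    rw [hεdef]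
    simp only
    rw [div_le_one (by positivity)]
    linarith [(Nat.cast_nonneg k : (0 : ℝ) ≤ k)]
  -- the atom at `0` is added to the first term, which preserves log convexity of the differences
  set u : ℕ → ℕ → ℝ := fun k n => w ((n + 1) * ε k) + if n = 0 then a / ε k else 0 with hu
  have hlog : ∀ k, LogConvexDiff (u k) := fun k =>
    h.logConvexDiff hw (hε k) (div_nonneg ha (hε k).le)
  set Ψ : ℝ → ℝ≥0∞ := fun θ => (ENNReal.ofReal θ * (ENNReal.ofReal a + laplace w θ))⁻¹ with hΨ
  have hΨfin : ∀ θ > 0, Ψ θ ≠ ∞ := fun θ hθ =>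
    ENNReal.inv_ne_top.2 (mul_ne_zero (by simpa using hθ) (hpos θ hθ))
  have hconv : ∀ θ > 0, Tendsto (fun k => laplace (stepFun (ε k) fun n => conjCoeff (u k) n / ε k) θ)
      atTop (𝓝 (Ψ θ)) := by
    intro θ hθ
    have h1 : Tendsto (fun k => ENNReal.ofReal (ε k * ∑' n, u k n * Real.exp (-θ * ε k) ^ n)) atTop
        (𝓝 (ENNReal.ofReal a + laplace w θ)) := by
      have h2 := (tendsto_const_nhds (x := ENNReal.ofReal a)).add
        (h.tendsto_riemann hε hε1 hlim hθ (hfin θ hθ))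
      refine h2.congr fun k => ?_
      have hz1 : Real.exp (-θ * ε k) < 1 := by
        rw [Real.exp_lt_one_iff]; nlinarith [hε k]
      have hnn : ∀ n, 0 ≤ ε k * (u k n * Real.exp (-θ * ε k) ^ n) := fun n =>
        mul_nonneg (hε k).le (mul_nonneg ((hlog k).pos n).le (by positivity))
      have hsum := summable_mul_exp (fun n => ((hlog k).pos n).le)
        (antitone_nat_of_succ_le (hlog k).anti) (Real.exp_pos _).le hz1
      rw [← tsum_mul_left, ENNReal.ofReal_tsum_of_nonneg hnn (hsum.mul_left _)]
      have hterm : ∀ n, ENNReal.ofReal (ε k * (u k n * Real.exp (-θ * ε k) ^ n)) =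
          (if n = 0 then ENNReal.ofReal a else 0) +
          ENNReal.ofReal (ε k * (w ((n + 1) * ε k) * Real.exp (-θ * ε k) ^ n)) := by
        intro n
        have hwn : 0 ≤ w ((n + 1) * ε k) := (hw _ (mul_pos (by positivity) (hε k))).le
        have hnn' : 0 ≤ ε k * (w ((n + 1) * ε k) * Real.exp (-θ * ε k) ^ n) :=
          mul_nonneg (hε k).le (mul_nonneg hwn (by positivity))
        rcases Nat.eq_zero_or_pos n with rfl | hn
        · rw [if_pos rfl, ← ENNReal.ofReal_add ha hnn']
          congr 1
          simp only [hu, if_pos, pow_zero, mul_one, mul_add]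
          rw [mul_div_cancel₀ _ (hε k).ne', add_comm]
        · simp only [hu, if_neg hn.ne', add_zero, zero_add]
      simp_rw [hterm]
      rw [ENNReal.tsum_add, tsum_ite_eq]
    have h3 := (ENNReal.Tendsto.const_mul h1 (a := ENNReal.ofReal θ)
      (Or.inr ENNReal.ofReal_ne_top)).inv
    refine h3.congr fun k => ?_
    rw [laplace_conj (hlog k) (hε k) hθ]
  -- a uniform bound for the transforms at `1`, from some index on
  obtain ⟨N, hN⟩ := eventually_atTop.1 ((hconv 1 one_pos).eventually
    (gt_mem_nhds (ENNReal.lt_add_right (hΨfin 1 one_pos) one_ne_zero)))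
  have hBfin : Ψ 1 + 1 ≠ ∞ := ENNReal.add_ne_top.2 ⟨hΨfin 1 one_pos, ENNReal.one_ne_top⟩
  set B := (Ψ 1 + 1).toReal
  have hsh : Tendsto (fun k => k + N) atTop atTop := tendsto_add_atTop_nat N
  have hc0 : ∀ k n, 0 ≤ conjCoeff (u k) n / ε k := fun k n =>
    div_nonneg ((hlog k).conj_nonneg n) (hε k).le
  have hcanti : ∀ k, Antitone fun n => conjCoeff (u k) n / ε k := fun k m n hmn =>
    div_le_div_of_nonneg_right ((hlog k).conj_anti hmn) (hε k).le
  have hM : ∀ k, ∀ x > 0, stepFun (ε (k + N)) (fun n => conjCoeff (u (k + N)) n / ε (k + N)) x ≤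
      B * Real.exp x / x := fun k x hx =>
    stepFun_le (hε _) (hc0 _) (hcanti _) hx ENNReal.toReal_nonneg
      (by rw [ENNReal.ofReal_toReal hBfin]; exact (hN (k + N) (by omega)).le)
  obtain ⟨φ, hφ, C, hC1, hC2, hC3, hC4⟩ := exists_subseq_tendsto_convex
    (ε := fun k => ε (k + N)) (fun k => hε _) (hlim.comp hsh)
    (c := fun k n => conjCoeff (u (k + N)) n / ε (k + N)) (fun k => hc0 _) (fun k => hcanti _)
    (fun k n => by
      rw [← sub_div, ← sub_div]
      exact div_le_div_of_nonneg_right ((hlog _).conj_convex n) (hε _).le) hM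
  obtain ⟨d, hd, hdΨ⟩ := exists_laplace_limit
    (S := fun k => stepFun (ε (φ k + N)) fun n => conjCoeff (u (φ k + N)) n / ε (φ k + N))
    (fun k => measurable_stepFun _ _) (fun k => stepFun_anti (hε _) (hcanti _))
    (fun k x hx => hM (φ k) x hx) hC4
    (fun θ hθ => (hconv θ hθ).comp (hsh.comp hφ.tendsto_atTop)) hΨfin
  exact ⟨d, hd, C, hC1, hC2, hC3, hdΨ⟩

/-! ### Laplace exponents from convex functions -/

/-- A non-increasing convex function `C ≥ 0` on `(0, ∞)` is a constant plus the tail of a measure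
with a non-increasing density. -/
lemma exists_tail_density {C : ℝ → ℝ} (hC : ConvexOn ℝ (Ioi 0) C) (hanti : AntitoneOn C (Ioi 0))
    (h0 : ∀ x > 0, 0 ≤ C x) :
    ∃ κ : ℝ, 0 ≤ κ ∧ ∃ g : ℝ → ℝ, AntitoneOn g (Ioi 0) ∧ (∀ x > 0, 0 ≤ g x) ∧
      ∀ y > 0, ENNReal.ofReal (C y) = (∫⁻ x in Ioi y, ENNReal.ofReal (g x)) + ENNReal.ofReal κ := by
  set g : ℝ → ℝ := fun x => -derivWithin C (Ioi x) x with hg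
  have hint : interior (Ioi (0 : ℝ)) = Ioi 0 := interior_Ioi
  have hganti : AntitoneOn g (Ioi 0) := by
    have := hC.monotoneOn_rightDeriv
    rw [hint] at this
    exact this.neg
  have hderiv : ∀ x > 0, HasDerivWithinAt C (-g x) (Ioi x) x := fun x hx => by
    rw [hg, neg_neg]
    exact hC.hasDerivWithinAt_rightDeriv_of_mem_interior (by rw [hint]; exact hx)
  have hg0 : ∀ x > 0, 0 ≤ g x := by
    intro x hx
    have h1 := hC.rightDeriv_le_slope_of_mem_interior (x := x) (y := x + 1) (by rw [hint]; exact hx)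
      (show (0 : ℝ) < x + 1 by linarith) (by linarith)
    have h2 : C (x + 1) ≤ C x := hanti hx (show (0 : ℝ) < x + 1 by linarith) (by linarith)
    rw [slope_def_field, show x + 1 - x = 1 by ring, div_one] at h1
    simp only [hg]
    linarith
  have hcont : ContinuousOn C (Ioi 0) := hC.continuousOn isOpen_Ioi
  -- the value at infinity
  have hseq : Antitone fun n : ℕ => C ((n : ℝ) + 1) := fun m n hmn =>
    hanti (show (0 : ℝ) < m + 1 by positivity) (show (0 : ℝ) < n + 1 by positivity) (by gcongr)
  have hlimn := tendsto_atTop_ciInf hseq ⟨0, by rintro _ ⟨n, rfl⟩; exact h0 _ (by positivity)⟩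
  set κ := ⨅ n : ℕ, C ((n : ℝ) + 1)
  have hκ : 0 ≤ κ := le_ciInf fun n => h0 _ (by positivity)
  have hlim : ∀ y > 0, Tendsto (fun n : ℕ => C (y + n)) atTop (𝓝 κ) := by
    intro y hy
    obtain ⟨m, hm⟩ := exists_nat_gt y
    refine tendsto_of_tendsto_of_tendsto_of_le_of_le' (hlimn.comp (tendsto_add_atTop_nat m))
      (hlimn.comp (tendsto_sub_atTop_nat 1)) (Eventually.of_forall fun n => ?_) ?_
    · refine hanti (show (0 : ℝ) < y + n by positivity)
        (show (0 : ℝ) < ((n + m : ℕ) : ℝ) + 1 by positivity) ?_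
      push_cast
      linarith
    · filter_upwards [eventually_ge_atTop 1] with n hn
      refine hanti (show (0 : ℝ) < ((n - 1 : ℕ) : ℝ) + 1 by positivity)
        (show (0 : ℝ) < y + n by positivity) ?_
      rw [Nat.cast_sub hn]
      push_cast
      linarith
  refine ⟨κ, hκ, g, hganti, hg0, fun y hy => ?_⟩
  have hIoc : ∀ n : ℕ, ∫⁻ x in Ioc y (y + n), ENNReal.ofReal (g x) =
      ENNReal.ofReal (C y - C (y + n)) := by
    intro n
    have hyn : y ≤ y + n := by simp
    have hsub : Icc y (y + n) ⊆ Ioi 0 := fun x hx => hy.trans_le hx.1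
    have hii : IntervalIntegrable g volume y (y + n) :=
      (hganti.mono (by rw [uIcc_of_le hyn]; exact hsub)).intervalIntegrable
    rw [← ofReal_integral_eq_lintegral_ofReal ((intervalIntegrable_iff_integrableOn_Ioc_of_le hyn).1
      hii) ((ae_restrict_iff' measurableSet_Ioc).2 (Eventually.of_forall fun x hx =>
      hg0 x (hy.trans hx.1))), ← intervalIntegral.integral_of_le hyn]
    congr 1
    have h1 := intervalIntegral.integral_eq_sub_of_hasDeriv_right_of_le hyn (f := C)
      (f' := fun x => -g x) (hcont.mono hsub) (fun x hx => hderiv x (hy.trans hx.1)) hii.neg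
    rw [intervalIntegral.integral_neg] at h1
    linarith
  have hmono : Monotone fun n : ℕ => Ioc y (y + n) := fun m n hmn =>
    Ioc_subset_Ioc_right (by gcongr)
  have hU : ⋃ n : ℕ, Ioc y (y + n) = Ioi y := by
    ext x
    simp only [mem_iUnion, mem_Ioc, mem_Ioi]
    refine ⟨fun ⟨n, hn⟩ => hn.1, fun hx => ?_⟩
    obtain ⟨n, hn⟩ := exists_nat_gt (x - y)
    exact ⟨n, hx, by linarith⟩
  have ht := tendsto_measure_iUnion_atTop
    (μ := volume.withDensity fun x => ENNReal.ofReal (g x)) hmono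
  rw [hU, withDensity_apply _ measurableSet_Ioi] at ht
  have ht' : Tendsto (fun n : ℕ => ENNReal.ofReal (C y - C (y + n))) atTop
      (𝓝 (∫⁻ x in Ioi y, ENNReal.ofReal (g x))) := ht.congr fun n => by
    rw [Function.comp, withDensity_apply _ measurableSet_Ioc, hIoc]
  have ht2 := ENNReal.tendsto_ofReal ((tendsto_const_nhds (x := C y)).sub (hlim y hy))
  rw [tendsto_nhds_unique ht' ht2, ← ENNReal.ofReal_add _ hκ, sub_add_cancel]
  exact sub_nonneg.2 (le_of_tendsto' (hlim y hy) fun n =>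
    hanti hy (show (0 : ℝ) < y + n by positivity) (by simp))

/-- Integration by parts: `θ ∫_0^∞ e^{-θy} C(y) dy` for a function `C` given by a tail density. -/
lemma mul_laplace_eq {C g : ℝ → ℝ} {κ θ : ℝ} (hθ : 0 < θ) (hg : AntitoneOn g (Ioi 0))
    (hC : ∀ y > 0, ENNReal.ofReal (C y) =
      (∫⁻ x in Ioi y, ENNReal.ofReal (g x)) + ENNReal.ofReal κ) :
    ENNReal.ofReal θ * laplace C θ = ENNReal.ofReal κ +
      ∫⁻ x in Ioi (0 : ℝ), ENNReal.ofReal (1 - Real.exp (-θ * x)) * ENNReal.ofReal (g x) := by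
  set e : ℝ → ℝ≥0∞ := fun y => ENNReal.ofReal θ * ENNReal.ofReal (Real.exp (-θ * y)) with he
  have hem : Measurable e := by fun_prop
  have h1 : ENNReal.ofReal θ * laplace C θ = ∫⁻ y in Ioi (0 : ℝ),
      (e y * ∫⁻ x in Ioi y, ENNReal.ofReal (g x)) + e y * ENNReal.ofReal κ := by
    rw [laplace, ← lintegral_const_mul' _ _ ENNReal.ofReal_ne_top]
    refine setLIntegral_congr_fun measurableSet_Ioi fun y hy => ?_
    rw [ENNReal.ofReal_mul (Real.exp_pos _).le, hC y hy, ← mul_assoc, mul_add]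
  have h2 : ∫⁻ y in Ioi (0 : ℝ), e y * ENNReal.ofReal κ = ENNReal.ofReal κ := by
    rw [lintegral_mul_const _ hem, he, lintegral_const_mul _ (by fun_prop), lintegral_exp_Ioi hθ,
      ← ENNReal.ofReal_mul hθ.le]
    simp [hθ.ne']
  rw [h1, lintegral_add_right _ (by fun_prop), h2, add_comm]
  congr 1
  have hgm : AEMeasurable g (volume.restrict (Ioi 0)) :=
    aemeasurable_restrict_of_antitoneOn measurableSet_Ioi hg
  set F : ℝ → ℝ → ℝ≥0∞ := fun y x =>
    {p : ℝ × ℝ | p.1 < p.2}.indicator (fun p => e p.1 * ENNReal.ofReal (g p.2)) (y, x) with hF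
  have hFm : AEMeasurable (Function.uncurry F)
      ((volume.restrict (Ioi 0)).prod (volume.restrict (Ioi (0 : ℝ)))) := by
    have : Function.uncurry F =
        {p : ℝ × ℝ | p.1 < p.2}.indicator (fun p => e p.1 * ENNReal.ofReal (g p.2)) := by
      ext ⟨y, x⟩; rfl
    rw [this]
    refine AEMeasurable.indicator ?_ (measurableSet_lt measurable_fst measurable_snd)
    exact (hem.comp measurable_fst).aemeasurable.mul hgm.comp_snd.ennreal_ofReal
  have hL : ∀ y ∈ Ioi (0 : ℝ), e y * ∫⁻ x in Ioi y, ENNReal.ofReal (g x) =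
      ∫⁻ x in Ioi (0 : ℝ), F y x := by
    intro y hy
    have hy' : (0 : ℝ) < y := hy
    rw [← lintegral_const_mul' _ _ (ENNReal.mul_ne_top ENNReal.ofReal_ne_top ENNReal.ofReal_ne_top)]
    have : ∀ x, F y x = (Ioi y).indicator (fun x => e y * ENNReal.ofReal (g x)) x := by
      intro x
      simp only [hF, indicator, mem_ofPred_eq, mem_Ioi]
    simp_rw [this]
    rw [setLIntegral_indicator measurableSet_Ioi, inter_eq_left.2 (Ioi_subset_Ioi hy'.le)]
  have hR : ∀ x ∈ Ioi (0 : ℝ), ∫⁻ y in Ioi (0 : ℝ), F y x =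
      ENNReal.ofReal (1 - Real.exp (-θ * x)) * ENNReal.ofReal (g x) := by
    intro x hx
    have hx' : (0 : ℝ) < x := hx
    have : ∀ y, F y x = (Iio x).indicator (fun y => e y * ENNReal.ofReal (g x)) y := by
      intro y
      simp only [hF, indicator, mem_ofPred_eq, mem_Iio]
    simp_rw [this]
    rw [setLIntegral_indicator measurableSet_Iio, inter_comm, Ioi_inter_Iio,
      lintegral_mul_const _ hem, he, lintegral_const_mul _ (by fun_prop),
      setLIntegral_congr Ioo_ae_eq_Ico, lintegral_exp_Ico hθ hx'.le, ← ENNReal.ofReal_mul hθ.le,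
      mul_div_cancel₀ _ hθ.ne', mul_zero, Real.exp_zero]
  rw [setLIntegral_congr_fun measurableSet_Ioi hL, lintegral_lintegral_swap hFm,
    setLIntegral_congr_fun measurableSet_Ioi hR]

/-- The reciprocal of `a + ∫_0^∞ e^{-θx} w(x) dx` is the Laplace exponent of a subordinator with a
non-increasing Lévy density. -/
theorem LogConvexDensity.exists_exponent {w : ℝ → ℝ} (h : LogConvexDensity w) {a : ℝ} (ha : 0 ≤ a)
    (hfin : ∀ θ > 0, laplace w θ ≠ ∞) (hpos : ∀ θ > 0, ENNReal.ofReal a + laplace w θ ≠ 0) :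
    ∃ κ d : ℝ, 0 ≤ κ ∧ 0 ≤ d ∧ ∃ g : ℝ → ℝ, AntitoneOn g (Ioi 0) ∧ (∀ x > 0, 0 ≤ g x) ∧
      ∀ θ > 0, (ENNReal.ofReal a + laplace w θ)⁻¹ = ENNReal.ofReal (κ + d * θ) +
        ∫⁻ x in Ioi (0 : ℝ), ENNReal.ofReal (1 - Real.exp (-θ * x)) * ENNReal.ofReal (g x) := by
  obtain ⟨d, hd, C, hC, hCanti, hC0, hCΨ⟩ := h.exists_convex ha hfin hpos
  obtain ⟨κ, hκ, g, hg, hg0, hgC⟩ := exists_tail_density hC hCanti hC0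
  refine ⟨κ, d, hκ, hd, g, hg, hg0, fun θ hθ => ?_⟩
  have h1 := hCΨ θ hθ
  have hθ' : ENNReal.ofReal θ ≠ 0 := by simpa using hθ
  rw [ENNReal.mul_inv (Or.inl hθ') (Or.inl ENNReal.ofReal_ne_top)] at h1
  have h2 : (ENNReal.ofReal a + laplace w θ)⁻¹ =
      ENNReal.ofReal θ * (ENNReal.ofReal d + laplace C θ) := by
    rw [← h1, ← mul_assoc, ENNReal.mul_inv_cancel hθ' ENNReal.ofReal_ne_top, one_mul]
  rw [h2, mul_add, mul_laplace_eq hθ hg hgC, ← add_assoc, ← ENNReal.ofReal_mul hθ.le,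
    ← ENNReal.ofReal_add (by positivity) hκ]
  congr 2
  ring

/-! ### Uniqueness of the Lévy measure -/

/-- Finite measures concentrated on `[0, 1]` with the same moments are equal. -/
lemma measure_ext_of_moments {μ₁ μ₂ : Measure ℝ} [IsFiniteMeasure μ₁] [IsFiniteMeasure μ₂]
    (h₁ : ∀ᵐ y ∂μ₁, |y| ≤ 1) (h₂ : ∀ᵐ y ∂μ₂, |y| ≤ 1)
    (h : ∀ n : ℕ, ∫ y, y ^ n ∂μ₁ = ∫ y, y ^ n ∂μ₂) : μ₁ = μ₂ := by
  have key : ∀ (μ : Measure ℝ) [IsFiniteMeasure μ], (∀ᵐ y ∂μ, |y| ≤ 1) → ∀ z : ℂ,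
      HasSum (fun n : ℕ => (z ^ n / n.factorial) * ((∫ y, y ^ n ∂μ : ℝ) : ℂ))
        (ProbabilityTheory.complexMGF id μ z) := by
    intro μ _ hμ z
    have h1 : ∀ n : ℕ, (z ^ n / n.factorial) * ((∫ y, y ^ n ∂μ : ℝ) : ℂ) =
        ∫ y : ℝ, (z * y) ^ n / n.factorial ∂μ := by
      intro n
      rw [← integral_complex_ofReal, ← integral_const_mul]
      refine integral_congr_ae (Eventually.of_forall fun y => ?_)
      simp only
      push_cast
      rw [mul_pow]
      ring
    simp_rw [h1]
    refine hasSum_integral_of_dominated_convergence (fun n _ => ‖z‖ ^ n / n.factorial)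
      (fun n => by fun_prop) (fun n => ?_) ?_ ?_ ?_
    · filter_upwards [hμ] with y hy
      rw [norm_div, norm_pow, norm_mul, Complex.norm_real, Complex.norm_natCast]
      gcongr
      calc ‖z‖ * ‖y‖ ≤ ‖z‖ * 1 := by gcongr; exact hy
        _ = ‖z‖ := mul_one _
    · exact Eventually.of_forall fun _ => Real.summable_pow_div_factorial ‖z‖
    · exact integrable_const _
    · refine Eventually.of_forall fun y => ?_
      have := NormedSpace.expSeries_div_hasSum_exp (z * (y : ℂ))
      rw [← Complex.exp_eq_exp_ℂ] at this
      exact this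
  refine Measure.ext_of_complexMGF_id_eq (funext fun z => ?_)
  have e1 := key μ₁ h₁ z
  simp_rw [h] at e1
  exact e1.unique (key μ₂ h₂ z)

lemma one_sub_exp_le_min (x : ℝ) : 1 - Real.exp (-x) ≤ min 1 x :=
  le_min (by linarith [Real.exp_pos (-x)]) (by linarith [Real.add_one_le_exp (-x)])

lemma min_le_two_mul {x : ℝ} (hx : 0 ≤ x) : min 1 x ≤ 2 * (1 - Real.exp (-x)) := by
  have h1 : Real.exp (-x) ≤ 1 / (1 + x) := by
    rw [Real.exp_neg, ← one_div]
    exact one_div_le_one_div_of_le (by positivity) (by linarith [Real.add_one_le_exp x])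
  have h2 : min 1 x / 2 ≤ 1 - 1 / (1 + x) := by
    rw [show 1 - 1 / (1 + x) = x / (1 + x) by field_simp; ring, div_le_div_iff₀ two_pos (by positivity)]
    rcases le_total x 1 with h | h
    · rw [min_eq_right h]; nlinarith
    · rw [min_eq_left h]; linarith
  linarith

lemma integrable_one_sub_exp {ν : Measure ℝ} (h0 : ν (Iic 0) = 0)
    (hfin : ∫⁻ x, ENNReal.ofReal (min 1 x) ∂ν < ∞) {θ : ℝ} (hθ : 0 ≤ θ) :
    Integrable (fun x => 1 - Real.exp (-θ * x)) ν := by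
  have hpos : ∀ᵐ x ∂ν, 0 < x := by
    rw [ae_iff]
    simpa [Iic] using h0
  have hmin : Integrable (fun x : ℝ => min 1 x) ν := by
    refine ⟨by fun_prop, ?_⟩
    rw [hasFiniteIntegral_iff_ofReal (hpos.mono fun x hx => le_min zero_le_one hx.le)]
    exact hfin
  refine (hmin.const_mul (max 1 θ)).mono' (by fun_prop) (hpos.mono fun x hx => ?_)
  have h1 : Real.exp (-θ * x) ≤ 1 := Real.exp_le_one_iff.2 (by nlinarith)
  rw [Real.norm_of_nonneg (by linarith)]
  rcases le_total x 1 with h | h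
  · rw [min_eq_right h]
    have := Real.add_one_le_exp (-θ * x)
    nlinarith [le_max_right 1 θ]
  · rw [min_eq_left h]
    linarith [le_max_left 1 θ, Real.exp_pos (-θ * x)]

/-- The Laplace exponent determines the Lévy measure. -/
theorem levyMeasure_ext {ν₁ ν₂ : Measure ℝ} (h₁ : ν₁ (Iic 0) = 0) (h₂ : ν₂ (Iic 0) = 0)
    (hfin₁ : ∫⁻ x, ENNReal.ofReal (min 1 x) ∂ν₁ < ∞)
    (hfin₂ : ∫⁻ x, ENNReal.ofReal (min 1 x) ∂ν₂ < ∞) {κ₁ κ₂ d₁ d₂ : ℝ} (hd₁ : 0 ≤ d₁) (hd₂ : 0 ≤ d₂)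
    (h : ∀ θ : ℝ, 0 ≤ θ → κ₁ + d₁ * θ + ∫ x, (1 - Real.exp (-θ * x)) ∂ν₁ =
      κ₂ + d₂ * θ + ∫ x, (1 - Real.exp (-θ * x)) ∂ν₂) : ν₁ = ν₂ := by
  -- the finite measure `d δ_0 + (1 - e^{-x}) ν(dx)`, whose Laplace transform is a difference of
  -- values of the Laplace exponent
  set ρ : ℝ → ℝ≥0∞ := fun x => ENNReal.ofReal (1 - Real.exp (-x)) with hρ
  have hρm : Measurable ρ := by fun_prop
  set m : Measure ℝ → ℝ → Measure ℝ := fun ν d =>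
    ν.withDensity ρ + ENNReal.ofReal d • Measure.dirac 0 with hm
  have hpos : ∀ {ν : Measure ℝ}, ν (Iic 0) = 0 → ∀ᵐ x ∂ν, 0 < x := fun hν => by
    rw [ae_iff]
    simpa [Iic] using hν
  have hfinite : ∀ {ν : Measure ℝ} (d : ℝ), ν (Iic 0) = 0 →
      ∫⁻ x, ENNReal.ofReal (min 1 x) ∂ν < ∞ → IsFiniteMeasure (m ν d) := by
    intro ν d hν hfin
    have : IsFiniteMeasure (ν.withDensity ρ) := isFiniteMeasure_withDensity (ne_top_of_le_ne_top
      hfin.ne (lintegral_mono_ae (Eventually.of_forall fun x =>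
        ENNReal.ofReal_le_ofReal (one_sub_exp_le_min x))))
    have : IsFiniteMeasure (ENNReal.ofReal d • Measure.dirac (0 : ℝ)) :=
      Measure.smul_finite _ ENNReal.ofReal_ne_top
    infer_instance
  have hae : ∀ {ν : Measure ℝ} (d : ℝ), ν (Iic 0) = 0 → ∀ᵐ x ∂(m ν d), 0 ≤ x := by
    intro ν d hν
    refine ae_add_measure_iff.2 ⟨?_, Measure.ae_smul_measure
      ((ae_dirac_iff measurableSet_Ici).2 le_rfl) _⟩
    exact (withDensity_absolutelyContinuous ν ρ).ae_le ((hpos hν).mono fun x hx => hx.le)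
  have hmom : ∀ {ν : Measure ℝ} {d : ℝ} (κ : ℝ), 0 ≤ d → ν (Iic 0) = 0 →
      ∫⁻ x, ENNReal.ofReal (min 1 x) ∂ν < ∞ → ∀ n : ℕ, ∫ x, Real.exp (-x) ^ n ∂(m ν d) =
        (κ + d * (n + 1) + ∫ x, (1 - Real.exp (-(n + 1) * x)) ∂ν) -
        (κ + d * n + ∫ x, (1 - Real.exp (-n * x)) ∂ν) := by
    intro ν d κ hd hν hfin n
    have hfm := hfinite d hν hfin
    have hInt : Integrable (fun x => Real.exp (-x) ^ n) (m ν d) := by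
      refine (integrable_const (1 : ℝ)).mono' (by fun_prop) ((hae d hν).mono fun x hx => ?_)
      rw [Real.norm_of_nonneg (by positivity)]
      exact pow_le_one₀ (Real.exp_pos _).le (Real.exp_le_one_iff.2 (by linarith))
    rw [integral_add_measure (hInt.mono_measure (Measure.le_add_right le_rfl))
      (hInt.mono_measure (Measure.le_add_left le_rfl)), integral_smul_measure, integral_dirac,
      integral_withDensity_eq_integral_toReal_smul hρm
        (Eventually.of_forall fun _ => ENNReal.ofReal_lt_top)]
    have e : ∫ x, (ρ x).toReal • Real.exp (-x) ^ n ∂ν =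
        ∫ x, ((1 - Real.exp (-(n + 1) * x)) - (1 - Real.exp (-n * x))) ∂ν := by
      refine integral_congr_ae ((hpos hν).mono fun x hx => ?_)
      simp only [hρ]
      rw [ENNReal.toReal_ofReal (by
        linarith [Real.exp_le_one_iff.2 (by linarith : -x ≤ 0)]), smul_eq_mul, ← Real.exp_nat_mul,
        show -((n : ℝ) + 1) * x = -x + n * -x by ring, Real.exp_add,
        show -(n : ℝ) * x = n * -x by ring]
      ring
    rw [e, integral_sub (integrable_one_sub_exp hν hfin (by positivity))
      (integrable_one_sub_exp hν hfin (by positivity))]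
    simp only [neg_zero, Real.exp_zero, one_pow, ENNReal.toReal_ofReal hd, smul_eq_mul, mul_one]
    ring
  have hexp : Measurable fun x : ℝ => Real.exp (-x) := by fun_prop
  have hlog : Measurable fun y : ℝ => -Real.log y := by fun_prop
  have hbd : ∀ {ν : Measure ℝ} (d : ℝ), ν (Iic 0) = 0 →
      ∀ᵐ y ∂((m ν d).map fun x => Real.exp (-x)), |y| ≤ 1 := by
    intro ν d hν
    rw [ae_map_iff hexp.aemeasurable
      (measurableSet_le (f := fun y : ℝ => |y|) (by fun_prop) measurable_const)]
    filter_upwards [hae d hν] with x hx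
    rw [abs_of_pos (Real.exp_pos _)]
    exact Real.exp_le_one_iff.2 (by linarith)
  have hmm : m ν₁ d₁ = m ν₂ d₂ := by
    have := hfinite d₁ h₁ hfin₁
    have := hfinite d₂ h₂ hfin₂
    have hmap : (m ν₁ d₁).map (fun x => Real.exp (-x)) = (m ν₂ d₂).map fun x => Real.exp (-x) := by
      refine measure_ext_of_moments (hbd d₁ h₁) (hbd d₂ h₂) fun n => ?_
      rw [integral_map hexp.aemeasurable (by fun_prop), integral_map hexp.aemeasurable (by fun_prop),
        hmom κ₁ hd₁ h₁ hfin₁, hmom κ₂ hd₂ h₂ hfin₂, h n (by positivity), h (n + 1) (by positivity)]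
    have := congrArg (fun μ : Measure ℝ => μ.map fun y => -Real.log y) hmap
    simp only [Measure.map_map hlog hexp] at this
    have hid : (fun y => -Real.log y) ∘ (fun x => Real.exp (-x)) = id := by
      ext x; simp
    rwa [hid, Measure.map_id, Measure.map_id] at this
  have hres : ∀ {ν : Measure ℝ} (d : ℝ), ν (Iic 0) = 0 →
      (m ν d).restrict (Ioi 0) = ν.withDensity ρ := by
    intro ν d hν
    have h3 : (Measure.dirac (0 : ℝ)).restrict (Ioi 0) = 0 := by
      rw [Measure.restrict_eq_zero, Measure.dirac_apply' _ measurableSet_Ioi]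
      simp
    rw [hm]
    simp only
    rw [Measure.restrict_add, Measure.restrict_smul, h3, smul_zero, add_zero]
    exact Measure.restrict_eq_self_of_ae_mem
      ((withDensity_absolutelyContinuous ν ρ).ae_le (hpos hν))
  have hinv : ∀ {ν : Measure ℝ}, ν (Iic 0) = 0 → (ν.withDensity ρ).withDensity ρ⁻¹ = ν := by
    intro ν hν
    refine withDensity_inv_same hρm ((hpos hν).mono fun x hx => ?_)
      (Eventually.of_forall fun _ => ENNReal.ofReal_ne_top)
    simp only [hρ, ne_eq, ENNReal.ofReal_eq_zero, not_le, sub_pos, Real.exp_lt_one_iff]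
    linarith
  rw [← hinv h₁, ← hinv h₂, ← hres d₁ h₁, ← hres d₂ h₂, hmm]

/-! ### The Laplace exponent of a subordinator -/

/-- A non-increasing multiplicative function on `[0, ∞)` with `f 1 > 0` is an exponential. -/
lemma exists_exp_of_mul {f : ℝ≥0 → ℝ} (hf : Antitone f) (hmul : ∀ s t, f (s + t) = f s * f t)
    (h0 : f 0 = 1) (h1 : 0 < f 1) : ∃ Φ : ℝ, 0 ≤ Φ ∧ ∀ t : ℝ≥0, f t = Real.exp (-t * Φ) := by
  have hpow : ∀ (n : ℕ) t, f (n * t) = f t ^ n := by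
    intro n t
    induction n with
    | zero => simp [h0]
    | succ n ih => rw [Nat.cast_succ, add_mul, one_mul, hmul, ih, pow_succ]
  have hpos : ∀ t, 0 < f t := by
    intro t
    obtain ⟨n, hn⟩ := exists_nat_gt t
    have := hpow n 1
    rw [mul_one] at this
    exact (this ▸ pow_pos h1 n).trans_le (hf hn.le)
  set Φ := -Real.log (f 1) with hΦ
  have hΦ0 : 0 ≤ Φ := by
    have : f 1 ≤ 1 := h0 ▸ hf zero_le_one
    linarith [Real.log_nonpos h1.le this]
  have hL : ∀ (n : ℕ) t, -Real.log (f (n * t)) = n * -Real.log (f t) := fun n t => by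
    rw [hpow, Real.log_pow]; ring
  have hLm : ∀ {s t}, s ≤ t → -Real.log (f s) ≤ -Real.log (f t) := fun hst =>
    neg_le_neg (Real.log_le_log (hpos _) (hf hst))
  refine ⟨Φ, hΦ0, fun t => ?_⟩
  have hlin : -Real.log (f t) = t * Φ := by
    have hb : ∀ n : ℕ, |n * (-Real.log (f t) - t * Φ)| ≤ Φ := by
      intro n
      set k := ⌊(n : ℝ≥0) * t⌋₊
      have k1 : (k : ℝ≥0) ≤ n * t := Nat.floor_le (by positivity)
      have k2 : (n : ℝ≥0) * t ≤ (k + 1 : ℕ) := by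
        push_cast; exact (Nat.lt_floor_add_one _).le
      have l1 := hLm k1
      have l2 := hLm k2
      have e1 := hL k 1
      have e2 := hL (k + 1) 1
      rw [mul_one] at e1 e2
      rw [hL, e1, ← hΦ] at l1
      rw [hL, e2, ← hΦ] at l2
      have k1' : (k : ℝ) ≤ n * t := by exact_mod_cast k1
      have k2' : (n : ℝ) * t ≤ k + 1 := by exact_mod_cast k2
      push_cast at l2
      rw [abs_le]
      constructor
      · nlinarith [mul_le_mul_of_nonneg_right k2' hΦ0]
      · nlinarith [mul_le_mul_of_nonneg_right k1' hΦ0]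
    by_contra hne
    have hne' : 0 < |-Real.log (f t) - t * Φ| := abs_pos.2 (sub_ne_zero.2 hne)
    obtain ⟨n, hn⟩ := exists_nat_gt (Φ / |-Real.log (f t) - t * Φ|)
    rw [div_lt_iff₀ hne'] at hn
    have := hb n
    rw [abs_mul, Nat.abs_cast] at this
    linarith
  rw [neg_mul, ← hlin, neg_neg, Real.exp_log (hpos t)]

/-- The function `x ↦ e^{-θx}` on `[0, ∞]`, with value `0` at the cemetery `∞` for every `θ`,
including `θ = 0`. -/
noncomputable def killedExp (θ : ℝ) (x : ℝ≥0∞) : ℝ≥0∞ :=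
  if x = ∞ then 0 else ENNReal.ofReal (Real.exp (-θ * x.toReal))

lemma measurable_killedExp (θ : ℝ) : Measurable (killedExp θ) :=
  Measurable.ite (measurableSet_singleton _) measurable_const (by fun_prop)

lemma killedExp_le_one {θ : ℝ} (hθ : 0 ≤ θ) (x : ℝ≥0∞) : killedExp θ x ≤ 1 := by
  rw [killedExp]
  split_ifs
  · exact zero_le_one
  · rw [← ENNReal.ofReal_one]
    refine ENNReal.ofReal_le_ofReal (Real.exp_le_one_iff.2 ?_)
    nlinarith [mul_nonneg hθ (ENNReal.toReal_nonneg (a := x))]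

lemma killedExp_anti {θ : ℝ} (hθ : 0 ≤ θ) : Antitone (killedExp θ) := by
  intro x y hxy
  rw [killedExp, killedExp]
  by_cases hy : y = ∞
  · simp [hy]
  · rw [if_neg hy, if_neg (ne_top_of_le_ne_top hy hxy)]
    refine ENNReal.ofReal_le_ofReal (Real.exp_le_exp.2 ?_)
    nlinarith [mul_le_mul_of_nonneg_left (ENNReal.toReal_mono hy hxy) hθ]

lemma killedExp_sub {θ : ℝ} {x y : ℝ≥0∞} (hx : x ≠ ∞) (hxy : x ≤ y) :
    killedExp θ y = killedExp θ x * killedExp θ (y - x) := by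
  rw [killedExp, killedExp, killedExp, if_neg hx]
  by_cases hy : y = ∞
  · rw [if_pos hy, hy, ENNReal.top_sub hx, if_pos rfl, mul_zero]
  · rw [if_neg hy, if_neg (ENNReal.sub_ne_top hy), ← ENNReal.ofReal_mul (Real.exp_pos _).le,
      ← Real.exp_add, ENNReal.toReal_sub_of_le hxy hy]
    congr 2
    ring

lemma eq_zero_of_killedExp_eq_one {θ : ℝ} (hθ : 0 < θ) {x : ℝ≥0∞} (h : killedExp θ x = 1) :
    x = 0 := by
  rw [killedExp] at h
  split_ifs at h with hx
  · exact absurd h zero_ne_one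
  · rw [ENNReal.ofReal_eq_one, Real.exp_eq_one_iff] at h
    have : x.toReal = 0 := by
      rcases mul_eq_zero.1 h with h | h
      · linarith
      · exact h
    exact (ENNReal.toReal_eq_zero_iff x).1 this |>.resolve_right hx

lemma killedExp_zero (θ : ℝ) : killedExp θ 0 = 1 := by simp [killedExp]

namespace Subord.IsSubordinator

variable {Ω : Type*} [MeasurableSpace Ω] {P : Measure Ω} {H : ℝ≥0 → Ω → ℝ≥0∞}

/-- The Laplace transform `E[e^{-θ H_t}; H_t < ∞]` of the law of `H_t` on `[0, ∞)`. -/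
noncomputable def transform (P : Measure Ω) (H : ℝ≥0 → Ω → ℝ≥0∞) (θ : ℝ) (t : ℝ≥0) : ℝ≥0∞ :=
  ∫⁻ ω, killedExp θ (H t ω) ∂P

variable (hH : IsSubordinator P H)
include hH

lemma integral_eq_transform (θ : ℝ) (t : ℝ≥0) :
    ∫ ω in {ω | H t ω < ∞}, Real.exp (-θ * (H t ω).toReal) ∂P = (transform P H θ t).toReal := by
  have hm := hH.measurable t
  have hset : MeasurableSet {ω | H t ω < ∞} := measurableSet_lt hm measurable_const
  rw [integral_eq_lintegral_of_nonneg_ae (Eventually.of_forall fun _ => (Real.exp_pos _).le)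
    (Real.measurable_exp.comp (hm.ennreal_toReal.const_mul (-θ))).aestronglyMeasurable, ← lintegral_indicator hset, transform]
  congr 2
  ext ω
  by_cases h : H t ω = ∞
  · simp [killedExp, h]
  · simp [killedExp, h, lt_top_iff_ne_top]

variable [IsProbabilityMeasure P]

lemma transform_add (θ : ℝ) (t s : ℝ≥0) :
    transform P H θ (t + s) = transform P H θ t * transform P H θ s := by
  have hm := hH.measurable
  have hset : MeasurableSet {ω | H t ω < ∞} := measurableSet_lt (hm t) measurable_const
  set Q := P.restrict {ω | H t ω < ∞} with hQ
  have hmD : Measurable fun ω => H (t + s) ω - H t ω := (hm _).sub (hm _)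
  have hprod : Q.map (fun ω => (H t ω, H (t + s) ω - H t ω)) =
      (Q.map (H t)).prod (P.map (H s)) := by
    refine (Measure.prod_eq fun A B hA hB => ?_).symm
    have hA' : MeasurableSet[⨆ u : Iic t, MeasurableSpace.comap (H u) inferInstance]
        (H t ⁻¹' A) := by
      exact le_iSup (fun u : Iic t => MeasurableSpace.comap (H u) inferInstance) ⟨t, le_refl t⟩ _
        ⟨A, hA, rfl⟩
    have hinc := hH.increments s t _ hA' B hB
    rw [Measure.map_apply ((hm t).prodMk hmD) (hA.prod hB), Measure.map_apply (hm t) hA,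
      Measure.map_apply (hm s) hB, hQ, Measure.restrict_apply ((hm t) hA),
      Measure.restrict_apply (((hm t).prodMk hmD) (hA.prod hB))]
    refine Eq.trans (congrArg P ?_) hinc
    ext ω
    simp only [mem_inter_iff, mem_preimage, mem_prod, mem_ofPred_eq]
    tauto
  have hrest : ∀ r, t ≤ r → transform P H θ r = ∫⁻ ω, killedExp θ (H r ω) ∂Q := by
    intro r hr
    rw [transform, hQ, ← lintegral_indicator hset]
    congr 1
    ext ω
    by_cases h : H t ω = ∞
    · have : H r ω = ∞ := top_le_iff.1 (h ▸ hH.mono ω hr)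
      simp [h, this, killedExp]
    · simp [lt_top_iff_ne_top, h]
  have hk := measurable_killedExp θ
  rw [hrest (t + s) (by simp), hrest t le_rfl]
  have h1 : ∫⁻ ω, killedExp θ (H (t + s) ω) ∂Q = ∫⁻ ω, (fun p : ℝ≥0∞ × ℝ≥0∞ =>
      killedExp θ p.1 * killedExp θ p.2) (H t ω, H (t + s) ω - H t ω) ∂Q := by
    rw [hQ]
    refine setLIntegral_congr_fun hset fun ω hω => ?_
    exact killedExp_sub (ne_of_lt hω) (hH.mono ω (by simp))
  rw [h1, ← lintegral_map (f := fun p : ℝ≥0∞ × ℝ≥0∞ => killedExp θ p.1 * killedExp θ p.2)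
    ((hk.comp measurable_fst).mul (hk.comp measurable_snd)) ((hm t).prodMk hmD), hprod,
    lintegral_prod_mul hk.aemeasurable hk.aemeasurable, lintegral_map hk (hm t),
    lintegral_map hk (hm s), transform]

omit hH in
lemma transform_le_one {θ : ℝ} (hθ : 0 ≤ θ) (t : ℝ≥0) : transform P H θ t ≤ 1 := by
  calc transform P H θ t ≤ ∫⁻ _, 1 ∂P := lintegral_mono fun ω => killedExp_le_one hθ _
    _ = 1 := by simp

lemma tendsto_transform_zero {θ : ℝ} (hθ : 0 ≤ θ) :
    Tendsto (fun n : ℕ => transform P H θ (1 / ((n : ℝ≥0) + 1))) atTop (𝓝 1) := by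
  have h1 : ∫⁻ _, 1 ∂P = 1 := by simp
  rw [← h1]
  refine tendsto_lintegral_of_dominated_convergence (fun _ => 1)
    (fun n => (measurable_killedExp θ).comp (hH.measurable _))
    (fun n => Eventually.of_forall fun ω => killedExp_le_one hθ _) (by simp)
    (Eventually.of_forall fun ω => ?_)
  have ht : Tendsto (fun n : ℕ => (1 : ℝ≥0) / ((n : ℝ≥0) + 1)) atTop (𝓝[Ici 0] 0) :=
    tendsto_nhdsWithin_iff.2 ⟨tendsto_one_div_add_atTop_nhds_zero_nat,
      Eventually.of_forall fun _ => mem_Ici.2 zero_le⟩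
  have hlim := (hH.right_cont ω 0).tendsto.comp ht
  rw [hH.zero ω] at hlim
  have hcont : Tendsto (killedExp θ) (𝓝 0) (𝓝 1) := by
    have h2 : Tendsto (fun x : ℝ≥0∞ => ENNReal.ofReal (Real.exp (-θ * x.toReal))) (𝓝 0) (𝓝 1) := by
      have h3 := ENNReal.tendsto_ofReal
        (((ENNReal.tendsto_toReal ENNReal.zero_ne_top).const_mul (-θ)).rexp)
      simpa using h3
    refine h2.congr' ?_
    filter_upwards [gt_mem_nhds ENNReal.zero_lt_top] with x hx
    rw [killedExp, if_neg hx.ne]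
  exact hcont.comp hlim

lemma exists_exponent {θ : ℝ} (hθ : 0 ≤ θ) :
    ∃ Φ : ℝ, 0 ≤ Φ ∧ ∀ t : ℝ≥0, transform P H θ t = ENNReal.ofReal (Real.exp (-t * Φ)) := by
  have hfin : ∀ t, transform P H θ t ≠ ∞ := fun t =>
    ne_top_of_le_ne_top ENNReal.one_ne_top (transform_le_one hθ t)
  have h0 : transform P H θ 0 = 1 := by simp [transform, hH.zero, killedExp_zero]
  have hpow : ∀ (n : ℕ) t, transform P H θ (n * t) = transform P H θ t ^ n := by
    intro n t
    induction n with
    | zero => simp [h0]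
    | succ n ih => rw [Nat.cast_succ, add_mul, one_mul, hH.transform_add, ih, pow_succ]
  have h1 : transform P H θ 1 ≠ 0 := by
    obtain ⟨n, hn⟩ := ((hH.tendsto_transform_zero hθ).eventually
      (lt_mem_nhds (show (0 : ℝ≥0∞) < 1 from zero_lt_one))).exists
    have := hpow (n + 1) (1 / ((n : ℝ≥0) + 1))
    rw [Nat.cast_succ, mul_one_div_cancel (by positivity)] at this
    rw [this]
    exact pow_ne_zero _ hn.ne'
  obtain ⟨Φ, hΦ, h⟩ := exists_exp_of_mul (f := fun t => (transform P H θ t).toReal)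
    (fun s t hst => ENNReal.toReal_mono (hfin s)
      (lintegral_mono fun ω => killedExp_anti hθ (hH.mono ω hst)))
    (fun s t => by rw [hH.transform_add, ENNReal.toReal_mul]) (by simp [h0])
    (ENNReal.toReal_pos h1 (hfin 1))
  exact ⟨Φ, hΦ, fun t => by rw [← h t, ENNReal.ofReal_toReal (hfin t)]⟩

omit hH in
/-- If `E[e^{-θ H_t}; H_t < ∞] = 1` for some `θ > 0`, then `H_t = 0` almost surely, and the same
holds for every `θ'`. -/
lemma transform_eq_one {θ : ℝ} (hθ : 0 < θ) {t : ℝ≥0} (h : transform P H θ t = 1) (θ' : ℝ) :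
    transform P H θ' t = 1 := by
  have hae : (fun ω => killedExp θ (H t ω)) =ᵐ[P] fun _ => 1 := by
    refine ae_eq_of_ae_le_of_lintegral_le
      (Eventually.of_forall fun ω => killedExp_le_one hθ.le _) ?_ aemeasurable_const ?_
    · rw [← transform, h]; exact ENNReal.one_ne_top
    · rw [← transform, h]; simp
  have : ∀ᵐ ω ∂P, killedExp θ' (H t ω) = 1 := by
    filter_upwards [hae] with ω hω
    rw [eq_zero_of_killedExp_eq_one hθ hω, killedExp_zero]
  rw [transform, lintegral_congr_ae this]
  simp

lemma tendsto_transform (t : ℝ≥0) :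
    Tendsto (fun n : ℕ => transform P H (1 / ((n : ℝ) + 1)) t) atTop (𝓝 (transform P H 0 t)) := by
  refine tendsto_lintegral_of_dominated_convergence (fun _ => 1)
    (fun n => (measurable_killedExp _).comp (hH.measurable _))
    (fun n => Eventually.of_forall fun ω => killedExp_le_one (by positivity) _) (by simp)
    (Eventually.of_forall fun ω => ?_)
  by_cases h : H t ω = ∞
  · simp [killedExp, h]
  · simp only [killedExp, h, if_false]
    have h0 := (tendsto_one_div_add_atTop_nhds_zero_nat (𝕜 := ℝ)).neg.mul_const (H t ω).toReal
    rw [neg_zero] at h0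
    rw [neg_zero]
    exact ENNReal.tendsto_ofReal h0.rexp

/-- The Laplace transform of the potential measure is the reciprocal of the Laplace exponent. -/
lemma lintegral_exp_potentialMeasure {θ Φ : ℝ} (hΦ : 0 < Φ)
    (h : ∀ t : ℝ≥0, transform P H θ t = ENNReal.ofReal (Real.exp (-t * Φ))) :
    ∫⁻ x, ENNReal.ofReal (Real.exp (-θ * x)) ∂(potentialMeasure P H) = (ENNReal.ofReal Φ)⁻¹ := by
  have hprob : ∀ t, IsProbabilityMeasure (P.map (H t)) := fun t =>
    Measure.isProbabilityMeasure_map (hH.measurable t).aemeasurable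
  have hmeas : Measurable fun t => P.map (H t) := by
    refine Measurable.measure_of_isPiSystem_of_isProbabilityMeasure
      (S := range Iic) (BorelSpace.measurable_eq.trans (borel_eq_generateFrom_Iic ℝ≥0∞))
      isPiSystem_Iic ?_
    rintro _ ⟨a, rfl⟩
    have : Antitone fun t => P.map (H t) (Iic a) := by
      intro s t hst
      simp only [Measure.map_apply (hH.measurable _) measurableSet_Iic]
      exact measure_mono fun ω hω => (hH.mono ω hst).trans hω
    exact this.measurable
  have hmeas' : Measurable fun t : ℝ => P.map (H t.toNNReal) :=
    hmeas.comp measurable_real_toNNReal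
  have hk := measurable_killedExp θ
  rw [potentialMeasure, lintegral_map (by fun_prop) ENNReal.measurable_toReal,
    ← lintegral_indicator (measurableSet_singleton _).compl]
  have hind : (({∞} : Set ℝ≥0∞)ᶜ.indicator fun x => ENNReal.ofReal (Real.exp (-θ * x.toReal))) =
      killedExp θ := by
    ext x
    by_cases hx : x = ∞ <;> simp [killedExp, hx]
  rw [hind, Measure.lintegral_bind hmeas'.aemeasurable hk.aemeasurable]
  have hF : ∀ t ∈ Ioi (0 : ℝ), ∫⁻ x, killedExp θ x ∂(P.map (H t.toNNReal)) =
      ENNReal.ofReal (Real.exp (-Φ * t)) := by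
    intro t ht
    rw [lintegral_map hk (hH.measurable _), ← transform, h, Real.coe_toNNReal t (le_of_lt ht)]
    congr 2
    ring
  rw [setLIntegral_congr Ioi_ae_eq_Ici.symm, setLIntegral_congr_fun measurableSet_Ioi hF,
    lintegral_exp_Ioi hΦ, mul_zero, Real.exp_zero, one_div, ENNReal.ofReal_inv_of_pos hΦ]

omit hH [IsProbabilityMeasure P] in
lemma potentialMeasure_Iio_zero : potentialMeasure P H (Iio 0) = 0 := by
  rw [potentialMeasure, Measure.map_apply ENNReal.measurable_toReal measurableSet_Iio]
  have : ENNReal.toReal ⁻¹' Iio 0 = ∅ := by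
    ext x
    simp
  rw [this, measure_empty]

omit hH [IsProbabilityMeasure P] in
/-- The potential measure is its density on `(0, ∞)` plus a possible atom at `0`. -/
lemma lintegral_exp_eq_add_laplace {w : ℝ → ℝ} (hw : HasDensityOnIoi (potentialMeasure P H) w)
    (hanti : AntitoneOn w (Ioi 0)) (θ : ℝ) :
    ∫⁻ x, ENNReal.ofReal (Real.exp (-θ * x)) ∂(potentialMeasure P H) =
      potentialMeasure P H {0} + laplace w θ := by
  have hwm : AEMeasurable w (volume.restrict (Ioi 0)) :=
    aemeasurable_restrict_of_antitoneOn measurableSet_Ioi hanti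
  rw [← lintegral_add_compl _ (measurableSet_Ioi (a := (0 : ℝ))), add_comm, compl_Ioi]
  congr 1
  · have h0 : (Iic (0 : ℝ)) =ᵐ[potentialMeasure P H] ({0} : Set ℝ) := by
      rw [← Iio_union_right]
      exact union_ae_eq_right_of_ae_eq_empty
        (ae_eq_empty.2 potentialMeasure_Iio_zero)
    rw [setLIntegral_congr h0, lintegral_singleton]
    simp
  · rw [hw.2, lintegral_withDensity_eq_lintegral_mul₀ hwm.ennreal_ofReal (by fun_prop), laplace]
    refine lintegral_congr fun x => ?_
    rw [Pi.mul_apply, mul_comm, ENNReal.ofReal_mul (Real.exp_pos _).le]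

end Subord.IsSubordinator

/-! ### The Lévy measure -/

namespace Subord

variable {Ω : Type*} [MeasurableSpace Ω] {P : Measure Ω} {H : ℝ≥0 → Ω → ℝ≥0∞}

lemma IsLevyMeasure.unique {ν₁ ν₂ : Measure ℝ} (h₁ : IsLevyMeasure P H ν₁)
    (h₂ : IsLevyMeasure P H ν₂) : ν₁ = ν₂ := by
  obtain ⟨h01, hfin1, κ₁, d₁, -, hd₁, he₁⟩ := h₁
  obtain ⟨h02, hfin2, κ₂, d₂, -, hd₂, he₂⟩ := h₂
  refine levyMeasure_ext h01 h02 hfin1 hfin2 hd₁ hd₂ (κ₁ := κ₁) (κ₂ := κ₂) fun θ hθ => ?_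
  have := (he₁ 1 θ hθ).symm.trans (he₂ 1 θ hθ)
  rw [Real.exp_eq_exp] at this
  simp only [NNReal.coe_one] at this
  linarith

/-- A Lévy–Khintchine representation of the Laplace exponent on `(0, ∞)` with Lévy density `g`
extends to `θ = 0`, and identifies the Lévy measure. -/
lemma IsSubordinator.isLevyMeasure_withDensity [IsProbabilityMeasure P] (hH : IsSubordinator P H)
    {Φ : ℝ → ℝ} (hΦ0 : ∀ θ, 0 ≤ θ → 0 ≤ Φ θ)
    (hΦ : ∀ θ, 0 ≤ θ → ∀ t : ℝ≥0, transform P H θ t = ENNReal.ofReal (Real.exp (-t * Φ θ)))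
    {κ d : ℝ} (hκ : 0 ≤ κ) (hd : 0 ≤ d) {g : ℝ → ℝ} (hg : AntitoneOn g (Ioi 0))
    (h : ∀ θ > 0, ENNReal.ofReal (Φ θ) = ENNReal.ofReal (κ + d * θ) +
      ∫⁻ x in Ioi (0 : ℝ), ENNReal.ofReal (1 - Real.exp (-θ * x)) * ENNReal.ofReal (g x)) :
    IsLevyMeasure P H
      ((volume.restrict (Ioi 0)).withDensity fun x => ENNReal.ofReal (g x)) := by
  set ν : Measure ℝ := (volume.restrict (Ioi 0)).withDensity fun x => ENNReal.ofReal (g x) with hν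
  have hgm : AEMeasurable (fun x => ENNReal.ofReal (g x)) (volume.restrict (Ioi 0)) :=
    (aemeasurable_restrict_of_antitoneOn measurableSet_Ioi hg).ennreal_ofReal
  have hlint : ∀ f : ℝ → ℝ≥0∞, Measurable f →
      ∫⁻ x, f x ∂ν = ∫⁻ x in Ioi (0 : ℝ), f x * ENNReal.ofReal (g x) := by
    intro f hf
    rw [hν, lintegral_withDensity_eq_lintegral_mul₀ hgm hf.aemeasurable]
    simp_rw [Pi.mul_apply, mul_comm]
  have hν0 : ν (Iic 0) = 0 := by
    rw [hν, withDensity_apply _ measurableSet_Iic, Measure.restrict_restrict measurableSet_Iic,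
      Iic_inter_Ioi, Ioc_self, Measure.restrict_empty, lintegral_zero_measure]
  have hpos : ∀ᵐ x ∂ν, 0 < x := by
    rw [ae_iff]
    simpa [Iic] using hν0
  have hfin1 : ∀ θ > 0, ∫⁻ x, ENNReal.ofReal (1 - Real.exp (-θ * x)) ∂ν ≠ ∞ := by
    intro θ hθ
    rw [hlint _ (by fun_prop)]
    exact ne_top_of_le_ne_top ENNReal.ofReal_ne_top ((h θ hθ).symm ▸ le_add_self)
  have hmin : ∫⁻ x, ENNReal.ofReal (min 1 x) ∂ν < ∞ := by
    have hle : ∫⁻ x, ENNReal.ofReal (min 1 x) ∂ν ≤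
        ∫⁻ x, ENNReal.ofReal 2 * ENNReal.ofReal (1 - Real.exp (-1 * x)) ∂ν := by
      refine lintegral_mono_ae (hpos.mono fun x hx => ?_)
      rw [← ENNReal.ofReal_mul two_pos.le, neg_one_mul]
      exact ENNReal.ofReal_le_ofReal (min_le_two_mul hx.le)
    refine hle.trans_lt ?_
    rw [lintegral_const_mul' _ _ ENNReal.ofReal_ne_top]
    exact ENNReal.mul_lt_top ENNReal.ofReal_lt_top (hfin1 1 one_pos).lt_top
  have hI := fun θ (hθ : (0 : ℝ) ≤ θ) => integrable_one_sub_exp hν0 hmin hθ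
  have hnn : ∀ θ : ℝ, 0 ≤ θ → 0 ≤ᵐ[ν] fun x => 1 - Real.exp (-θ * x) := fun θ hθ =>
    hpos.mono fun x hx => by
      have : Real.exp (-θ * x) ≤ 1 := Real.exp_le_one_iff.2 (by nlinarith)
      simpa using this
  have hpexp : ∀ θ > 0, Φ θ = κ + d * θ + ∫ x, (1 - Real.exp (-θ * x)) ∂ν := by
    intro θ hθ
    have h1 := h θ hθ
    rw [← hlint _ (by fun_prop), ← ofReal_integral_eq_lintegral_ofReal (hI θ hθ.le)
      (hnn θ hθ.le), ← ENNReal.ofReal_add (by positivity) (integral_nonneg_of_ae (hnn θ hθ.le)),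
      ENNReal.ofReal_eq_ofReal_iff (hΦ0 θ hθ.le) (add_nonneg (by positivity)
        (integral_nonneg_of_ae (hnn θ hθ.le)))] at h1
    exact h1
  -- at `θ = 0` both sides are the limits of their values at `1 / (n + 1)`
  have hzero : Φ 0 = κ := by
    set θ : ℕ → ℝ := fun n => 1 / ((n : ℝ) + 1) with hθdef
    have hθ0 : ∀ n, 0 < θ n := fun n => Nat.one_div_pos_of_nat
    have hθl : Tendsto θ atTop (𝓝 0) := tendsto_one_div_add_atTop_nhds_zero_nat
    have hθ1 : ∀ n, θ n ≤ 1 := fun n => by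
      simp only [hθdef]
      rw [div_le_one (by positivity)]
      linarith [(Nat.cast_nonneg n : (0 : ℝ) ≤ n)]
    have hint : Tendsto (fun n => ∫ x, (1 - Real.exp (-θ n * x)) ∂ν) atTop
        (𝓝 (∫ _, (0 : ℝ) ∂ν)) := by
      refine tendsto_integral_of_dominated_convergence (fun x => 1 - Real.exp (-1 * x))
        (fun n => by fun_prop) (hI 1 zero_le_one) (fun n => hpos.mono fun x hx => ?_)
        (Eventually.of_forall fun x => ?_)
      · have h1 : Real.exp (-θ n * x) ≤ 1 := Real.exp_le_one_iff.2 (by nlinarith [hθ0 n])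
        have h2 : Real.exp (-1 * x) ≤ Real.exp (-θ n * x) :=
          Real.exp_le_exp.2 (by nlinarith [hθ1 n])
        rw [Real.norm_of_nonneg (by linarith)]
        linarith
      · have := (tendsto_const_nhds (x := (1 : ℝ))).sub (hθl.neg.mul_const x).rexp
        simpa using this
    have h1 : Tendsto (fun n => Φ (θ n)) atTop (𝓝 κ) := by
      have := ((tendsto_const_nhds (x := κ)).add (hθl.const_mul d)).add hint
      simp only [mul_zero, add_zero, integral_zero] at this
      exact this.congr fun n => (hpexp _ (hθ0 n)).symm
    have h2 := ENNReal.tendsto_ofReal h1.neg.rexp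
    have h3 := hH.tendsto_transform 1
    simp_rw [hΦ 0 le_rfl 1] at h3
    have h4 : Tendsto (fun n => ENNReal.ofReal (Real.exp (-Φ (θ n)))) atTop
        (𝓝 (ENNReal.ofReal (Real.exp (-((1 : ℝ≥0) : ℝ) * Φ 0)))) := h3.congr fun n => by
      rw [hΦ (θ n) (hθ0 n).le 1]
      simp
    have h5 := tendsto_nhds_unique h4 h2
    rw [ENNReal.ofReal_eq_ofReal_iff (Real.exp_pos _).le (Real.exp_pos _).le,
      Real.exp_eq_exp] at h5
    simpa using h5
  refine ⟨hν0, hmin, κ, d, hκ, hd, fun t θ hθ => ?_⟩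
  rw [hH.integral_eq_transform, hΦ θ hθ, ENNReal.toReal_ofReal (Real.exp_pos _).le]
  congr 2
  rcases hθ.eq_or_lt with rfl | hθ'
  · simp [hzero]
  · exact hpexp θ hθ'

lemma hasDensityOnIoi_withDensity {g : ℝ → ℝ} (hg : ∀ x > 0, 0 ≤ g x) :
    HasDensityOnIoi ((volume.restrict (Ioi 0)).withDensity fun x => ENNReal.ofReal (g x)) g := by
  refine ⟨hg, ?_⟩
  rw [restrict_withDensity measurableSet_Ioi, Measure.restrict_restrict measurableSet_Ioi,
    inter_self]

/-- If the potential density is log convex in the sense of `LogConvexDensity`, the reciprocal of its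
Laplace transform provides a Lévy measure with a non-increasing density. -/
lemma IsSubordinator.exists_levyMeasure [IsProbabilityMeasure P] (hH : IsSubordinator P H)
    {w : ℝ → ℝ} (hw : HasDensityOnIoi (potentialMeasure P H) w) (hlog : LogConvexDensity w) :
    ∃ g : ℝ → ℝ, AntitoneOn g (Ioi 0) ∧ (∀ x > 0, 0 ≤ g x) ∧ IsLevyMeasure P H
      ((volume.restrict (Ioi 0)).withDensity fun x => ENNReal.ofReal (g x)) := by
  have hex : ∀ θ : ℝ, ∃ Φ : ℝ, 0 ≤ θ → 0 ≤ Φ ∧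
      ∀ t : ℝ≥0, transform P H θ t = ENNReal.ofReal (Real.exp (-t * Φ)) := by
    intro θ
    by_cases hθ : 0 ≤ θ
    · obtain ⟨Φ, h⟩ := hH.exists_exponent hθ
      exact ⟨Φ, fun _ => h⟩
    · exact ⟨0, fun h => absurd h hθ⟩
  choose Φ hΦ' using hex
  have hΦ0 : ∀ θ, 0 ≤ θ → 0 ≤ Φ θ := fun θ hθ => (hΦ' θ hθ).1
  have hΦ : ∀ θ, 0 ≤ θ → ∀ t : ℝ≥0, transform P H θ t = ENNReal.ofReal (Real.exp (-t * Φ θ)) :=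
    fun θ hθ => (hΦ' θ hθ).2
  by_cases hdeg : ∃ θ > 0, Φ θ = 0
  · -- the process that stays at `0`
    obtain ⟨θ, hθ, hzero⟩ := hdeg
    have hall : ∀ θ', 0 ≤ θ' → Φ θ' = 0 := by
      intro θ' hθ'
      have h1 : transform P H θ 1 = 1 := by rw [hΦ θ hθ.le, hzero]; simp
      have h2 := transform_eq_one hθ h1 θ'
      rw [hΦ θ' hθ', ENNReal.ofReal_eq_one, Real.exp_eq_one_iff] at h2
      simpa using h2
    refine ⟨fun _ => 0, antitoneOn_const, fun _ _ => le_rfl,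
      hH.isLevyMeasure_withDensity hΦ0 hΦ le_rfl le_rfl antitoneOn_const fun θ hθ => ?_⟩
    simp [hall θ hθ.le]
  · push Not at hdeg
    have hΦpos : ∀ θ > 0, 0 < Φ θ := fun θ hθ => (hΦ0 θ hθ.le).lt_of_ne' (hdeg θ hθ)
    have hid : ∀ θ > 0, potentialMeasure P H {0} + laplace w θ = (ENNReal.ofReal (Φ θ))⁻¹ :=
      fun θ hθ => by
        rw [← lintegral_exp_eq_add_laplace hw hlog.anti,
          hH.lintegral_exp_potentialMeasure (hΦpos θ hθ) (hΦ θ hθ.le)]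
    have hne : ∀ θ > 0, (ENNReal.ofReal (Φ θ))⁻¹ ≠ ∞ := fun θ hθ =>
      ENNReal.inv_ne_top.2 (by simpa using hΦpos θ hθ)
    have hatom : potentialMeasure P H {0} ≠ ∞ :=
      ne_top_of_le_ne_top (hne 1 one_pos) (hid 1 one_pos ▸ le_self_add)
    have ha : ENNReal.ofReal (potentialMeasure P H {0}).toReal = potentialMeasure P H {0} :=
      ENNReal.ofReal_toReal hatom
    obtain ⟨κ, d, hκ, hd, g, hg, hg0, hrep⟩ := hlog.exists_exponent
      (a := (potentialMeasure P H {0}).toReal) ENNReal.toReal_nonneg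
      (fun θ hθ => ne_top_of_le_ne_top (hne θ hθ) (hid θ hθ ▸ le_add_self))
      (fun θ hθ => by
        rw [ha, hid θ hθ]
        exact ENNReal.inv_ne_zero.2 ENNReal.ofReal_ne_top)
    refine ⟨g, hg, hg0, hH.isLevyMeasure_withDensity hΦ0 hΦ hκ hd hg fun θ hθ => ?_⟩
    rw [← hrep θ hθ, ha, hid θ hθ, inv_inv]

end Subord

theorem corollary2p3 {Ω : Type*} [MeasurableSpace Ω] (P : Measure Ω) [IsProbabilityMeasure P]
    (H : ℝ≥0 → Ω → ℝ≥0∞) (hH : Subord.IsSubordinator P H)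
    (w : ℝ → ℝ)
    (hw : Subord.HasDensityOnIoi (Subord.potentialMeasure P H) w)
    (hw_anti : AntitoneOn w (Ioi 0))
    (hw_diff : DifferentiableOn ℝ w (Ioi 0))
    (hw'_anti : AntitoneOn (fun x => -deriv w x) (Ioi 0))
    (hw'_log : Subord.LogConvexOn (Ioi 0) (fun x => -deriv w x)) :
    (∃ ν : Measure ℝ, Subord.IsLevyMeasure P H ν) ∧
      ∀ ν : Measure ℝ, Subord.IsLevyMeasure P H ν →
        ∃ g : ℝ → ℝ, AntitoneOn g (Ioi 0) ∧ Subord.HasDensityOnIoi ν g := by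
  obtain ⟨g, hg, hg0, hν⟩ :=
    hH.exists_levyMeasure hw ⟨hw.1, hw_anti, hw_diff, hw'_anti, hw'_log⟩
  exact ⟨⟨_, hν⟩, fun ν h => ⟨g, hg, h.unique hν ▸ Subord.hasDensityOnIoi_withDensity hg0⟩⟩
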